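/- **Setting.** *NBG.* An NBG *membership structure* is a nonempty set $D$ (of *classes*) with a binary relation $\in$ satisfying Gödel's 18 axioms of NBG (groups A--E, with foundation and global choice), where a *set* is a class that is a member of some class; let $D_v\subseteq D$ be the collection of sets. Formulas of the language $L_{\rm nbg}$ are built from atoms $V(x)$, $(x=y)$, $(x\in y)$ by $\neg,\vee,\exists x$; the variables are the members of a fixed countably infinite set $\mathcal S$ of *symbols* that contains 16 key words (`op`, `type`, `term`, `formula`, `op-app`, `var`, `type-app`, `dep-fun-type`, `fun-app`, `fun-abs`, `if`, `exists`, `def-des`, `indef-des`, `quote`, `eval`). A *model of NBG* is an NBG membership structure together with the predicate $V$ (being a set) and equality (interpreted as identity); $\models_{\rm nbg}A$ means that $A$ is true in all models of NBG under all assignments. *Languages and expressions of Chiron.* A *language* is a pair $L=(\mathcal O,\theta)$, where $\mathcal O$ is a countable set of *operator names*, disjoint from $\mathcal S$, and $\theta$ assigns to each $o\in\mathcal O$ a signature form, a nonempty finite sequence $s_1,\dots,s_{n+1}$ of the words type, term, formula. It contains the 18 built-in names, with signature forms: `set`, `class`, `lang`, `expr-sym` (type); `op-names` (term); `expr-op-name`,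 `expr`, `expr-op`, `expr-type`, `expr-term`, `expr-formula` (term, type); `expr-term-type` (term, term, type); `in` (term, term, formula); `type-equal` (type, type, formula); `term-equal` (term, term, type, formula); `formula-equal`, `or` (formula, formula, formula); `not` (formula, formula). *Expressions* are the elements of $\mathcal S\cup\mathcal O$ and all finite sequences $(e_1,\dots,e_n)$, $n\ge0$, of expressions. *Proper* expressions are operators, types, terms (each with an assigned type) and formulas, generated as follows; here $\alpha,\beta,\gamma$ are types, $a$ is a term, $b$ a term of type $\beta$, $c$ a term of type $\gamma$, $A,B$ are formulas, $x\in\mathcal S$, $(x:\alpha)$ is $(\mathsf{var},x,\alpha)$, and a kind $k$ is $\mathsf{type}$, a type, or $\mathsf{formula}$. Operators: $(o::k_1,\dots,k_{n+1})=(\mathsf{op},o,k_1,\dots,k_{n+1})$ with kinds $k_i$ matching $\theta(o)$. Of kind $k_{n+1}$ is $(o::k_1,\dots,k_{n+1})(e_1,\dots,e_n)=(\mathsf{op\text{-}app},(\mathsf{op},o,k_1,\dots,k_{n+1}),e_1,\dots,e_n)$, where $e_i$ is a type, any term, or a formula according as $k_i$ is $\mathsf{type}$, a type, or $\mathsf{formula}$.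 Types: $(\mathsf{type\text{-}app},\alpha,a)$ and $(\mathsf{dep\text{-}fun\text{-}type},(x:\alpha),\beta)$. Terms: $(x:\alpha)$, $(\mathsf{def\text{-}des},(x:\alpha),B)$ and $(\mathsf{indef\text{-}des},(x:\alpha),B)$ of type $\alpha$; $(\mathsf{fun\text{-}app},f,a)$ of type $(\mathsf{type\text{-}app},\alpha,a)$ for $f$ of type $\alpha$; $(\mathsf{fun\text{-}abs},(x:\alpha),b)$ of type $(\mathsf{dep\text{-}fun\text{-}type},(x:\alpha),\beta)$; $(\mathsf{if},A,b,c)$ of type $\beta$ if $\beta=\gamma$ and of type $\mathsf C$ otherwise; $(\mathsf{quote},e)$, for any expression $e$, of type $(\mathsf{expr}::\mathsf L,\mathsf{type})(\ell)$. Formulas: $(\mathsf{exists},(x:\alpha),B)$. Of kind $k$: $(\mathsf{eval},a,k)$. Here $\mathsf V=(\mathsf{set}::\mathsf{type})()$, $\mathsf C=(\mathsf{class}::\mathsf{type})()$, $\mathsf L=(\mathsf{lang}::\mathsf{type})()$, $\ell=(\mathsf{op\text{-}names}::\mathsf V)()$. *Structures.* A *structure* for $L$ consists of an NBG membership structure $(D,\in)$;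 a choice function $\xi$ on the nonempty *superclasses* (subcollections of $D$; a class is identified with the superclass of its members); an injection $G$ of $\mathcal S\cup\mathcal O$ into the nonempty sets of $D_v$ that are not ordered pairs, extended to the map $H$ from expressions to sets by $H(())=\emptyset$, $H((e_1,\dots,e_n))=\langle H(e_1),H((e_2,\dots,e_n))\rangle$; and, for each $o\in\mathcal O$, a total operation $I(o)$ from $D_1\times\dots\times D_n$ to $D_{n+1}$, where $D_i$ is the collection of superclasses, $D\cup\{\bot\}$, or $\{\mathrm T,\mathrm F\}$ according as $s_i$ is type, term, or formula. With $D_{on}=G(\mathcal O)$, it is required that $I(\mathsf{set})=D_v$, $I(\mathsf{class})=D$, $I(\mathsf{op\text{-}names})=D_{on}$ (so $D_{on}$ is a class), $I(\mathsf{lang})=\{x\in D: x\subseteq D_{on}\}$, $I(\mathsf{expr\text{-}sym})=G(\mathcal S)$; that $I(\mathsf{expr\text{-}op\text{-}name})(x)=x$ if $x\subseteq D_{on}$; that $I(\mathsf{expr})(x)$ [and, for `expr-op`, `expr-type`, `expr-term`, `expr-formula`, likewise $I(\cdot)(x)$] is, if $x\subseteq D_{on}$, the collection of all $H(e)$ where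 $e$ is an expression [an operator, type, term, formula] with $G(o)\in x$ for all operator names $o$ occurring in $e$; all of these are $D$ at $x=\bot$ and different from $D$ at the other classes $x$; that $I(\mathsf{expr\text{-}term\text{-}type})(x,H(\alpha))$ is, if $x\subseteq D_{on}$ and $\alpha$ is a type, the collection of all such $H(e)$ with $e$ a term of type $\alpha$, while $I(\mathsf{expr\text{-}term\text{-}type})(x,y)$ is $D$ if $x=\bot$ or $y=\bot$ and is different from $D$ otherwise; that $I(\mathsf{in})(x,y)=\mathrm T$ iff $x\in y$ (both being classes), $I(\mathsf{type\text{-}equal})$ and $I(\mathsf{formula\text{-}equal})$ test identity, $I(\mathsf{term\text{-}equal})(x,y,\Sigma)=\mathrm T$ iff $x=y\in\Sigma$, and $I(\mathsf{not})$, $I(\mathsf{or})$ are the Boolean operations. *Standard valuation.* For an assignment $\varphi:\mathcal S\to D$, the value $V_\varphi(e)$ of a proper expression is defined recursively (improper expressions have no value). The *undefined* value of a type is $D$, of a term $\bot$, of a formula $\mathrm F$. An operator $(o::k_1,\dots,k_{n+1})$ denotes $I(o)$, changed to the undefined value of kind $k_{n+1}$ wherever some argument, or the result, at a place where $k_i$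 is a type, is neither $\bot$ nor in $V_\varphi(k_i)$; operator application is application. $V_\varphi((x:\alpha))=\varphi(x)$ if $\varphi(x)\in V_\varphi(\alpha)$. Functions are classes of ordered pairs of sets that are univocal; $(\mathsf{type\text{-}app},\alpha,a)$ denotes $\{f(V_\varphi(a)) : f \text{ a function in } V_\varphi(\alpha)\}$ if $V_\varphi(a)\neq\bot$ and this is a class; $(\mathsf{dep\text{-}fun\text{-}type},(x:\alpha),\beta)$ denotes the collection of functions $g$ with $d\in V_\varphi(\alpha)$ and $g(d)\in V_{\varphi[x\mapsto d]}(\beta)$ whenever $g(d)$ is defined; $(\mathsf{fun\text{-}app},f,a)$ denotes the value, if defined, of the function denoted by $f$ at $V_\varphi(a)$; $(\mathsf{fun\text{-}abs},(x:\alpha),b)$ denotes the function $\{\langle d,d'\rangle : d\in V_\varphi(\alpha)\cap D_v,\ d'=V_{\varphi[x\mapsto d]}(b)\in D_v\}$ if this is a class; $\mathsf{if}$ is the conditional; $(\mathsf{exists},(x:\alpha),B)$ is $\mathrm T$ iff $V_{\varphi[x\mapsto d]}(B)=\mathrm T$ for some $d\in V_\varphi(\alpha)$; $\mathsf{def\text{-}des}$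 denotes the unique such $d$, and $\mathsf{indef\text{-}des}$ the value of $\xi$ at the superclass of all such $d$ if this is nonempty; $V_\varphi((\mathsf{quote},e))=H(e)$. Finally $V_\varphi((\mathsf{eval},a,k))=V_\varphi(e)$ if $V_\varphi(a)=H(e)$ where $e$ is a type, term or formula according as $k$ is $\mathsf{type}$, a type, or $\mathsf{formula}$, the symbol $\mathsf{eval}$ occurs in $e$ only within quotations, and $V_\varphi(e)\in V_\varphi(k)$ if $k$ is a type. In every case not covered, the value is undefined in the above sense. A formula $A$ of $L$ is *valid*, $\models A$, if $V_\varphi(A)=\mathrm T$ for all structures for $L$ and all assignments $\varphi$. *The translation.* Define $\Phi(x)=(x:\mathsf C)$ and $$\Phi(V(x))=(\Phi(x)=_{\mathsf V}\Phi(x)),\quad \Phi(x=y)=(\Phi(x)=_{\mathsf C}\Phi(y)),\quad \Phi(x\in y)=(\mathsf{in}::\mathsf V,\mathsf C,\mathsf{formula})(\Phi(x),\Phi(y)),$$ $$\Phi(\neg A)=(\mathsf{not}::\mathsf{formula},\mathsf{formula})(\Phi(A)),\quad \Phi(A\vee B)=(\mathsf{or}::\mathsf{formula},\mathsf{formula},\mathsf{formula})(\Phi(A),\Phi(B)),$$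 $$\Phi(\exists x.A)=(\mathsf{exists},(x:\mathsf C),\Phi(A)),$$ where $(a=_\alpha b)$ is $(\mathsf{term\text{-}equal}::\mathsf C,\mathsf C,\mathsf{type},\mathsf{formula})(a,b,\alpha)$. **Theorem.** Let $L$ be any language of Chiron. For all formulas $A$ of $L_{\rm nbg}$, $$\models_{\rm nbg}A\quad\text{iff}\quad\models\Phi(A).$$ That is, $\Phi$ is a faithful interpretation of NBG in Chiron: $\Phi$ maps variables to terms of $L$ and formulas to formulas of $L$, $\models_{\rm nbg}A$ implies $\models\Phi(A)$, and $\models\Phi(A)$ implies $\models_{\rm nbg}A$, for all formulas $A$ of $L_{\rm nbg}$. -/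

import Mathlib

universe u

namespace Chiron

/-! ### NBG set theory -/

section SetTheory

variable {D : Type u} (mem : D → D → Prop)

/-- `w` is the unordered pair `{a, b}`. -/
def IsUPair (w a b : D) : Prop := ∀ z, mem z w ↔ z = a ∨ z = b

/-- `p` is the (Kuratowski) ordered pair `⟨a, b⟩ = {{a}, {a, b}}`. -/
def IsOPair (p a b : D) : Prop :=
  ∃ s t, IsUPair mem s a a ∧ IsUPair mem t a b ∧ IsUPair mem p s t

/-- `⟨a, b⟩ ∈ x`. -/
def PairMem (a b x : D) : Prop := ∃ p, IsOPair mem p a b ∧ mem p x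

/-- `⟨a, b, c⟩ = ⟨a, ⟨b, c⟩⟩ ∈ x`. -/
def TripleMem (a b c x : D) : Prop :=
  ∃ q p, IsOPair mem q b c ∧ IsOPair mem p a q ∧ mem p x

/-- The 18 axioms of Gödel's axiomatization of NBG, for a domain `D` of classes with a predicate
`V` (being a set) and a membership relation (`V_iff` comprises two of them: everything is a class,
and the sets are the members of classes). -/
structure IsNBG (V : D → Prop) (mem : D → D → Prop) : Prop where
  V_iff : ∀ x, V x ↔ ∃ y, mem x y
  extensionality : ∀ x y, (∀ u, V u → (mem u x ↔ mem u y)) → x = y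
  pairing : ∀ a b, V a → V b → ∃ w, V w ∧ IsUPair mem w a b
  membership : ∃ x, ∀ a b, V a → V b → (PairMem mem a b x ↔ mem a b)
  intersection : ∀ x y, ∃ z, ∀ a, V a → (mem a z ↔ mem a x ∧ mem a y)
  complement : ∀ x, ∃ y, ∀ a, V a → (mem a y ↔ ¬ mem a x)
  domain : ∀ x, ∃ y, ∀ a, V a → (mem a y ↔ ∃ b, V b ∧ PairMem mem a b x)
  cylinder : ∀ x, ∃ y, ∀ a b, V a → V b → (PairMem mem a b y ↔ mem a x)
  converse : ∀ x, ∃ y, ∀ a b, V a → V b → (PairMem mem a b y ↔ PairMem mem b a x)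
  rotation : ∀ x, ∃ y, ∀ a b c, V a → V b → V c →
    (TripleMem mem a b c y ↔ TripleMem mem b c a x)
  transposition : ∀ x, ∃ y, ∀ a b c, V a → V b → V c →
    (TripleMem mem a b c y ↔ TripleMem mem a c b x)
  infinity : ∃ a, V a ∧ (∃ b, mem b a) ∧
    ∀ b, mem b a → ∃ c, mem c a ∧ (∀ z, mem z b → mem z c) ∧ b ≠ c
  sum : ∀ a, V a → ∃ s, V s ∧ ∀ z, V z → (mem z s ↔ ∃ b, mem z b ∧ mem b a)
  power : ∀ a, V a → ∃ p, V p ∧ ∀ b, V b → (mem b p ↔ ∀ z, mem z b → mem z a)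
  replacement : ∀ x, (∀ a b b', V a → V b → V b' →
      PairMem mem a b x → PairMem mem a b' x → b = b') →
    ∀ a, V a → ∃ r, V r ∧ ∀ t, V t → (mem t r ↔ ∃ s, V s ∧ mem s a ∧ PairMem mem s t x)
  foundation : ∀ x, (∃ a, mem a x) → ∃ a, mem a x ∧ ∀ b, ¬ (mem b a ∧ mem b x)
  choice : ∃ f, (∀ p, mem p f → ∃ a b, V a ∧ V b ∧ IsOPair mem p a b) ∧
    (∀ a b b', V a → V b → V b' → PairMem mem a b f → PairMem mem a b' f → b = b') ∧
    ∀ a, V a → (∃ b, mem b a) → ∃ b, mem b a ∧ PairMem mem a b f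

end SetTheory

/-! ### Symbols of Chiron -/

/-- The 16 key words. -/
inductive Keyword
  | op | type | term | formula | opApp | var | typeApp | depFunType
  | funApp | funAbs | cond | ex | defDes | indefDes | quote | eval

/-- The countably infinite set of symbols; it contains the key words. -/
inductive Symbol
  | kw (k : Keyword)
  | id (n : ℕ)

/-! ### First-order formulas of NBG, and their semantics -/

/-- Formulas of the language of NBG; the variables are the symbols of Chiron. -/
inductive NBGFormula
  | isSet (x : Symbol)
  | eq (x y : Symbol)
  | mem (x y : Symbol)
  | neg (A : NBGFormula)
  | or (A B : NBGFormula)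
  | ex (x : Symbol) (A : NBGFormula)

/-- A model of NBG (in first-order logic with equality). -/
structure NBGModel where
  D : Type u
  nonempty : Nonempty D
  V : D → Prop
  eq : D → D → Prop
  mem : D → D → Prop
  eq_iff : ∀ x y, eq x y ↔ x = y
  isNBG : IsNBG V mem

open Classical in
/-- The assignment `φ[x ↦ d]`. -/
noncomputable def upd {D : Type u} (φ : Symbol → D) (x : Symbol) (d : D) : Symbol → D :=
  fun y => if y = x then d else φ y

/-- The valuation of formulas in a model of NBG. -/
def NBGModel.Sat (N : NBGModel.{u}) : NBGFormula → (Symbol → N.D) → Prop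
  | .isSet x, φ => N.V (φ x)
  | .eq x y, φ => N.eq (φ x) (φ y)
  | .mem x y, φ => N.mem (φ x) (φ y)
  | .neg A, φ => ¬ N.Sat A φ
  | .or A B, φ => N.Sat A φ ∨ N.Sat B φ
  | .ex x A, φ => ∃ d, N.Sat A (upd φ x d)

/-- `⊨_nbg A`. -/
def NBGValid (A : NBGFormula) : Prop := ∀ (N : NBGModel.{u}) (φ : Symbol → N.D), N.Sat A φ

/-! ### Languages and expressions of Chiron -/

/-- The sorts `type`, `term`, `formula` occurring in signature forms. -/
inductive SForm
  | type | term | formula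

/-- A signature form `s₁, …, sₙ, sₙ₊₁`: `args = [s₁, …, sₙ]` and `res = sₙ₊₁`. -/
structure SigForm where
  args : List SForm
  res : SForm

/-- The whole sequence `s₁, …, sₙ, sₙ₊₁`. -/
def SigForm.toList (F : SigForm) : List SForm := F.args ++ [F.res]

/-- The 18 built-in operator names. -/
inductive BuiltIn
  | set | cls | opNames | lang | exprSym | exprOpName | expr | exprOp | exprType | exprTerm
  | exprTermType | exprFormula | mem | typeEqual | termEqual | formulaEqual | not | or

/-- The signature forms of the built-in operator names. -/
def BuiltIn.sig : BuiltIn → SigForm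
  | .set => ⟨[], .type⟩
  | .cls => ⟨[], .type⟩
  | .opNames => ⟨[], .term⟩
  | .lang => ⟨[], .type⟩
  | .exprSym => ⟨[], .type⟩
  | .exprOpName => ⟨[.term], .type⟩
  | .expr => ⟨[.term], .type⟩
  | .exprOp => ⟨[.term], .type⟩
  | .exprType => ⟨[.term], .type⟩
  | .exprTerm => ⟨[.term], .type⟩
  | .exprTermType => ⟨[.term, .term], .type⟩
  | .exprFormula => ⟨[.term], .type⟩
  | .mem => ⟨[.term, .term], .formula⟩
  | .typeEqual => ⟨[.type, .type], .formula⟩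
  | .termEqual => ⟨[.term, .term, .type], .formula⟩
  | .formulaEqual => ⟨[.formula, .formula], .formula⟩
  | .not => ⟨[.formula], .formula⟩
  | .or => ⟨[.formula, .formula], .formula⟩

/-- A language of Chiron: countably many operator names (none of them a symbol) with signature
forms, the built-in ones among them.  A language is given by its further operator names. -/
structure Language where
  Extra : Type
  countable : Countable Extra
  sigExtra : Extra → SigForm

/-- The operator names of a language. -/
abbrev Language.OpName (L : Language) : Type := BuiltIn ⊕ L.Extra

/-- The function `θ`, assigning signature forms to the operator names. -/
def Language.θ (L : Language) : L.OpName → SigForm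
  | .inl b => b.sig
  | .inr o => L.sigExtra o

/-- S-expressions over the symbols and a set `O` of operator names. -/
inductive Expr (O : Type)
  | sym (s : Symbol)
  | opn (o : O)
  | list (es : List (Expr O))

/-- The expressions of `L`. -/
abbrev Language.Ex (L : Language) : Type := Expr L.OpName

namespace Expr

variable {O : Type}

/-- A key word, as an expression. -/
abbrev key (k : Keyword) : Expr O := .sym (.kw k)

/-- `(var, x, α)`. -/
abbrev var (x : Symbol) (α : Expr O) : Expr O := .list [key .var, .sym x, α]

/-- The operator name `o` occurs in an expression. -/
inductive Occurs (o : O) : Expr O → Prop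
  | here : Occurs o (.opn o)
  | inside (e : Expr O) (es : List (Expr O)) : e ∈ es → Occurs o e → Occurs o (.list es)

/-- The list of the components of a quotation `(quote, e)`. -/
def isQuotation : List (Expr O) → Bool
  | [.sym (.kw .quote), _] => true
  | _ => false

mutual
/-- The number of occurrences of the symbol `eval` that are not within a quotation. -/
def evalCount : Expr O → ℕ
  | .sym (.kw .eval) => 1
  | .sym _ => 0
  | .opn _ => 0
  | .list es => if isQuotation es then 0 else evalCountList es
/-- The sum of `evalCount` over a list. -/
def evalCountList : List (Expr O) → ℕ
  | [] => 0
  | e :: es => evalCount e + evalCountList es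
end

/-- All occurrences of the symbol `eval` are within a quotation. -/
def EvalFree (e : Expr O) : Prop := e.evalCount = 0

theorem evalCount_le_of_mem {e : Expr O} {es : List (Expr O)} (h : e ∈ es) :
    e.evalCount ≤ evalCountList es := by
  induction es with
  | nil => simp at h
  | cons a as ih =>
    simp only [evalCountList]
    rcases List.mem_cons.1 h with rfl | h
    · omega
    · have := ih h
      omega

theorem lex_of_mem [SizeOf O] {e : Expr O} {es : List (Expr O)} (h : e ∈ es) (hq : isQuotation es = false) :
    Prod.Lex (· < ·) (· < ·) (e.evalCount, sizeOf e) ((Expr.list es).evalCount,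
      sizeOf (Expr.list es)) := by
  have h1 := evalCount_le_of_mem h
  have h2 : evalCount (.list es) = evalCountList es := by simp [evalCount, hq]
  have h3 := List.sizeOf_lt_of_mem h
  rw [h2]
  rcases h1.lt_or_eq with h1 | h1
  · exact Prod.Lex.left _ _ h1
  · rw [h1]
    exact Prod.Lex.right _ (by simp only [Expr.list.sizeOf_spec]; omega)

theorem lex_of_mem_mem [SizeOf O] {e : Expr O} {es fs : List (Expr O)} (h : e ∈ es)
    (hq : isQuotation es = false) (h' : Expr.list es ∈ fs) (hq' : isQuotation fs = false) :
    Prod.Lex (· < ·) (· < ·) (e.evalCount, sizeOf e) ((Expr.list fs).evalCount,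
      sizeOf (Expr.list fs)) :=
  Prod.Lex.trans (lex_of_mem h hq) (lex_of_mem h' hq')

theorem lex_of_evalFree [SizeOf O] {e a k : Expr O} (h : e.EvalFree) :
    Prod.Lex (· < ·) (· < ·) (e.evalCount, sizeOf e)
      ((Expr.list [key .eval, a, k]).evalCount, sizeOf (Expr.list [key .eval, a, k])) :=
  Prod.Lex.left _ _ (by
    rw [show e.evalCount = 0 from h]
    simp [evalCount, evalCountList, isQuotation])

end Expr

open Chiron.Expr

namespace Language

variable (L : Language)

/-- The operator application `(o :: k₁, …, kₙ₊₁)(e₁, …, eₙ)` of a built-in operator. -/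
abbrev app (b : BuiltIn) (ks es : List L.Ex) : L.Ex :=
  .list (key .opApp :: .list (key .op :: .opn (.inl b) :: ks) :: es)

/-- The type `V` of all sets. -/
abbrev tyV : L.Ex := L.app .set [key .type] []

/-- The type `C` of all classes. -/
abbrev tyC : L.Ex := L.app .cls [key .type] []

/-- The constant `ℓ`. -/
abbrev ell : L.Ex := L.app .opNames [L.tyV] []

/-- The type `L`. -/
abbrev tyL : L.Ex := L.app .lang [key .type] []

/-- The type `E` of constructions of expressions. -/
abbrev tyE : L.Ex := L.app .expr [L.tyL, key .type] [L.ell]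

mutual

/-- `L.Assigns e e'`: `e` is a proper expression of `L` to which the expression `e'` is
assigned. -/
inductive Assigns : L.Ex → L.Ex → Prop
  | op (o : L.OpName) (ks : List L.Ex) :
      ks.length = (L.θ o).toList.length →
      (∀ (i : ℕ) (s : SForm) (k : L.Ex), (L.θ o).toList[i]? = some s → ks[i]? = some k →
        KindOf s k) →
      Assigns (.list (key .op :: .opn o :: ks)) (key .op)
  | opApp (o : L.OpName) (ks : List L.Ex) (k : L.Ex) (es : List L.Ex) :
      Assigns (.list (key .op :: .opn o :: (ks ++ [k]))) (key .op) →
      es.length = ks.length →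
      (∀ (i : ℕ) (k e : L.Ex), ks[i]? = some k → es[i]? = some e → ArgOf k e) →
      Assigns (.list (key .opApp :: .list (key .op :: .opn o :: (ks ++ [k])) :: es)) k
  | var (x : Symbol) (α : L.Ex) : Assigns α (key .type) → Assigns (var x α) α
  | typeApp (α a τ : L.Ex) : Assigns α (key .type) → Assigns a τ → Assigns τ (key .type) →
      Assigns (.list [key .typeApp, α, a]) (key .type)
  | depFunType (x : Symbol) (α β : L.Ex) : Assigns α (key .type) → Assigns β (key .type) →
      Assigns (.list [key .depFunType, var x α, β]) (key .type)
  | funApp (f α a τ : L.Ex) : Assigns f α → Assigns α (key .type) →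
      Assigns a τ → Assigns τ (key .type) →
      Assigns (.list [key .funApp, f, a]) (.list [key .typeApp, α, a])
  | funAbs (x : Symbol) (α b β : L.Ex) : Assigns α (key .type) →
      Assigns b β → Assigns β (key .type) →
      Assigns (.list [key .funAbs, var x α, b]) (.list [key .depFunType, var x α, β])
  | condSame (A b c β : L.Ex) : Assigns A (key .formula) →
      Assigns b β → Assigns β (key .type) → Assigns c β →
      Assigns (.list [key .cond, A, b, c]) β
  | condDiff (A b c β γ : L.Ex) : Assigns A (key .formula) →
      Assigns b β → Assigns β (key .type) → Assigns c γ → Assigns γ (key .type) → β ≠ γ →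
      Assigns (.list [key .cond, A, b, c]) L.tyC
  | ex (x : Symbol) (α B : L.Ex) : Assigns α (key .type) → Assigns B (key .formula) →
      Assigns (.list [key .ex, var x α, B]) (key .formula)
  | defDes (x : Symbol) (α B : L.Ex) : Assigns α (key .type) → Assigns B (key .formula) →
      Assigns (.list [key .defDes, var x α, B]) α
  | indefDes (x : Symbol) (α B : L.Ex) : Assigns α (key .type) → Assigns B (key .formula) →
      Assigns (.list [key .indefDes, var x α, B]) α
  | quote (e : L.Ex) : Assigns (.list [key .quote, e]) L.tyE
  | eval (a τ k : L.Ex) (s : SForm) : Assigns a τ → Assigns τ (key .type) → KindOf s k →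
      Assigns (.list [key .eval, a, k]) k

/-- `KindOf s k`: `k` is a kind, and a legitimate entry for `s` in the signature of an operator. -/
inductive KindOf : SForm → L.Ex → Prop
  | type : KindOf .type (key .type)
  | term (k : L.Ex) : Assigns k (key .type) → KindOf .term k
  | formula : KindOf .formula (key .formula)

/-- `ArgOf k e`: `e` is a legitimate argument of an operator at a place of kind `k`. -/
inductive ArgOf : L.Ex → L.Ex → Prop
  | type (e : L.Ex) : Assigns e (key .type) → ArgOf (key .type) e
  | term (k e τ : L.Ex) : Assigns k (key .type) → Assigns e τ → Assigns τ (key .type) → ArgOf k e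
  | formula (e : L.Ex) : Assigns e (key .formula) → ArgOf (key .formula) e

end

/-- Proper expressions. -/
def IsProper (e : L.Ex) : Prop := ∃ e', L.Assigns e e'

/-- Operators. -/
def IsOp (e : L.Ex) : Prop := L.Assigns e (key .op)

/-- Types. -/
def IsType (e : L.Ex) : Prop := L.Assigns e (key .type)

/-- Terms of type `α`. -/
def IsTermOf (e α : L.Ex) : Prop := L.Assigns e α ∧ L.IsType α

/-- Terms. -/
def IsTerm (e : L.Ex) : Prop := ∃ α, L.IsTermOf e α

/-- Formulas. -/
def IsFormula (e : L.Ex) : Prop := L.Assigns e (key .formula)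

end Language

/-! ### Prestructures -/

/-- A prestructure: a nonempty domain with a membership relation satisfying the axioms of NBG. -/
structure Prestructure where
  /-- The domain of classes. -/
  D : Type u
  mem : D → D → Prop
  nonempty : Nonempty D
  isNBG : IsNBG (fun x => ∃ y, mem x y) mem

namespace Prestructure

variable (P : Prestructure.{u})

/-- A set is a class that is a member of a class. -/
def IsSet (x : P.D) : Prop := ∃ y, P.mem x y

/-- A class, considered as a superclass, i.e. as a collection of classes. -/
def ext (x : P.D) : Set P.D := {y | P.mem y x}

/-- The functions of a prestructure. -/
def IsFunction (f : P.D) : Prop :=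
  (∀ p, P.mem p f → ∃ x y, P.IsSet x ∧ P.IsSet y ∧ IsOPair P.mem p x y) ∧
  ∀ x y y', PairMem P.mem x y f → PairMem P.mem x y' f → y = y'

open Classical in
/-- The value `f(x)`, where `none` means that it is undefined. -/
noncomputable def app (f x : P.D) : Option P.D :=
  if h : P.IsFunction f ∧ ∃! y, PairMem P.mem x y f then some h.2.choose else none

/-- The collection of all values `f(x)` with a function `f` in `S`. -/
def values (S : Set P.D) (x : P.D) : Set P.D :=
  {y | ∃ f ∈ S, P.IsFunction f ∧ P.app f x = some y}

open Classical in
/-- The value of a type application: `values S x` if `x ≠ ⊥` and that collection is a class, and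
the universal superclass otherwise. -/
noncomputable def typeApp (S : Set P.D) : Option P.D → Set P.D
  | some x => if ∃ c, P.ext c = P.values S x then P.values S x else Set.univ
  | none => Set.univ

/-- The empty class. -/
noncomputable def empty : P.D :=
  @Classical.epsilon _ P.nonempty fun x => ∀ z, ¬ P.mem z x

/-- The ordered pair of two sets. -/
noncomputable def opair (x y : P.D) : P.D :=
  @Classical.epsilon _ P.nonempty fun p => IsOPair P.mem p x y

variable {O : Type} (G : Symbol ⊕ O → P.D)

mutual
/-- The construction of an expression, given the constructions `G` of symbols and operator
names. -/
noncomputable def constr : Expr O → P.D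
  | .sym s => G (.inl s)
  | .opn o => G (.inr o)
  | .list es => constrList es
/-- The construction of the expression `(e₁, …, eₙ)`. -/
noncomputable def constrList : List (Expr O) → P.D
  | [] => P.empty
  | e :: es => P.opair (constr e) (constrList es)
end

end Prestructure

/-! ### Operations -/

/-- The two truth values. -/
inductive TV : Type u
  | t | f

open Classical in
/-- The truth value of a proposition. -/
noncomputable def TV.of (p : Prop) : TV.{u} := if p then .t else .f

/-- The domains of values of types (superclasses), of terms (classes, or `⊥ = none`) and of
formulas (truth values). -/
def Dom (D : Type u) : SForm → Type u
  | .type => Set D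
  | .term => Option D
  | .formula => TV.{u}

/-- The `n`-ary operations from `D₁ × ⋯ × Dₙ` to `Dₙ₊₁`, in curried form. -/
def Operation (D : Type u) : List SForm → SForm → Type u
  | [], r => Dom D r
  | s :: ss, r => Dom D s → Operation D ss r

/-- The values of proper expressions of Chiron: superclasses (values of types), classes and the
undefined value `⊥` (values of terms), truth values (of formulas), and operations (of operators). -/
inductive Value (D : Type u) : Type u
  | type (S : Set D)
  | term (d : Option D)
  | formula (p : TV.{u})
  | op (F : SigForm) (f : Operation D F.args F.res)

section Operations

variable {D : Type u}

/-- The value of an undefined type, term or formula: the universal superclass, `⊥`, or false. -/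
noncomputable def Dom.undef : (s : SForm) → Dom D s
  | .type => (Set.univ : Set D)
  | .term => (none : Option D)
  | .formula => TV.f

/-- An element of one of the domains, as a value. -/
def Dom.toValue : (s : SForm) → Dom D s → Value D
  | .type, S => .type S
  | .term, d => .term d
  | .formula, p => .formula p

/-- The superclass denoted by a type. -/
def Value.superclass : Option (Value D) → Set D
  | some (.type S) => S
  | _ => Set.univ

/-- The class, or `⊥`, denoted by a term. -/
def Value.cls : Option (Value D) → Option D
  | some (.term d) => d
  | _ => none

/-- The truth value denoted by a formula. -/
def Value.truth : Option (Value D) → TV.{u}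
  | some (.formula p) => p
  | _ => .f

/-- A value, as an element of the domain of a given sort (only used where it is of that sort). -/
noncomputable def Value.toDom : (s : SForm) → Option (Value D) → Dom D s
  | .type, v => Value.superclass v
  | .term, v => Value.cls v
  | .formula, v => Value.truth v

/-- A formula denotes the truth value true. -/
def Value.IsTrue (v : Option (Value D)) : Prop := v = some (.formula .t)

/-- If `s = term`, then `d` is `⊥` or in the value `v` of the kind at its place. -/
def Dom.InKind : (s : SForm) → Dom D s → Option (Value D) → Prop
  | .type, _, _ => True
  | .term, d, v => ∀ x : D, (d : Option D) = some x → x ∈ Value.superclass v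
  | .formula, _, _ => True

open Classical in
/-- The restriction of an operation to the values `vs` of the kinds of a signature: where an
argument or the result violates its kind (or `ok` does not hold), the result is undefined. -/
noncomputable def Operation.restrict (ok : Prop) (vs : List (Option (Value D))) :
    (ss : List SForm) → (r : SForm) → Operation D ss r → Operation D ss r
  | [], r, d => if ok ∧ Dom.InKind r d vs.head?.join then d else Dom.undef r
  | s :: ss, r, f => fun d =>
      Operation.restrict (ok ∧ Dom.InKind s d vs.head?.join) vs.tail ss r (f d)

/-- The application of an operation to a list of values. -/
noncomputable def Operation.apply : (ss : List SForm) → (r : SForm) → Operation D ss r →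
    List (Option (Value D)) → Dom D r
  | [], _, d, _ => d
  | s :: ss, r, f, vs => Operation.apply ss r (f (Value.toDom s vs.head?.join)) vs.tail

end Operations

/-! ### Structures -/

/-- The members of `Y` that are constructed only from symbols and the operator names with
constructions in the class `x`, where `Y` is given by the set `E` of the expressions that are
represented. -/
def Prestructure.constrSet (P : Prestructure.{u}) {O : Type} (G : Symbol ⊕ O → P.D)
    (E : Set (Expr O)) (x : P.D) : Set P.D :=
  {c | ∃ e ∈ E, P.constr G e = c ∧ ∀ o, Occurs o e → P.mem (G (.inr o)) x}

/-- The operation `f`, from `D_c ∪ {⊥}` to superclasses, yields `Y x` where `x ⊆ D_on`, it yields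
`D_c` at `⊥`, and something else than `D_c` otherwise. -/
def Prestructure.IsConstrOp (P : Prestructure.{u}) (Don : Set P.D) (Y : P.D → Set P.D)
    (f : Option P.D → Set P.D) : Prop :=
  f none = Set.univ ∧
  ∀ x, (P.ext x ⊆ Don → f (some x) = Y x) ∧ (¬ P.ext x ⊆ Don → f (some x) ≠ Set.univ)

/-- A structure for `L`. -/
structure Structure (L : Language) extends Prestructure.{u} where
  /-- The choice function on superclasses. -/
  ξ : Set D → D
  ξ_mem : ∀ S : Set D, S.Nonempty → ξ S ∈ S
  /-- The constructions of symbols and operator names: `G` is a bijection onto its range, which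
  is thus a countably infinite collection of sets, and none of them is empty or an ordered pair. -/
  G : Symbol ⊕ L.OpName → D
  G_injective : Function.Injective G
  G_isSet : ∀ a, toPrestructure.IsSet (G a)
  G_ne_empty : ∀ a, ∃ z, mem z (G a)
  G_ne_pair : ∀ a x y, ¬ IsOPair mem (G a) x y
  /-- The interpretation of the operator names. -/
  I : (o : L.OpName) → Operation D (L.θ o).args (L.θ o).res
  I_set : (I (.inl .set) : Set D) = {x | toPrestructure.IsSet x}
  I_cls : (I (.inl .cls) : Set D) = Set.univ
  I_opNames : ∃ c, (I (.inl .opNames) : Option D) = some c ∧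
    toPrestructure.ext c = Set.range fun o => G (.inr o)
  I_lang : (I (.inl .lang) : Set D) =
    {x | toPrestructure.ext x ⊆ Set.range fun o => G (.inr o)}
  I_exprSym : (I (.inl .exprSym) : Set D) = Set.range fun s => G (.inl s)
  I_exprOpName : toPrestructure.IsConstrOp (Set.range fun o => G (.inr o))
    (fun x => toPrestructure.ext x) (I (.inl .exprOpName))
  I_expr : toPrestructure.IsConstrOp (Set.range fun o => G (.inr o))
    (toPrestructure.constrSet G Set.univ) (I (.inl .expr))
  I_exprOp : toPrestructure.IsConstrOp (Set.range fun o => G (.inr o))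
    (toPrestructure.constrSet G {e | L.IsOp e}) (I (.inl .exprOp))
  I_exprType : toPrestructure.IsConstrOp (Set.range fun o => G (.inr o))
    (toPrestructure.constrSet G {e | L.IsType e}) (I (.inl .exprType))
  I_exprTerm : toPrestructure.IsConstrOp (Set.range fun o => G (.inr o))
    (toPrestructure.constrSet G {e | L.IsTerm e}) (I (.inl .exprTerm))
  I_exprTermType : ∀ f : Option D → Option D → Set D, f = I (.inl .exprTermType) →
    (∀ x y, x = none ∨ y = none → f x y = Set.univ) ∧
    (∀ x α, toPrestructure.ext x ⊆ (Set.range fun o => G (.inr o)) → L.IsType α →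
      f (some x) (some (toPrestructure.constr G α)) =
        toPrestructure.constrSet G {e | L.IsTermOf e α} x) ∧
    (∀ x y, ¬ (toPrestructure.ext x ⊆ (Set.range fun o => G (.inr o)) ∧
        ∃ α, L.IsType α ∧ toPrestructure.constr G α = y) →
      f (some x) (some y) ≠ Set.univ)
  I_exprFormula : toPrestructure.IsConstrOp (Set.range fun o => G (.inr o))
    (toPrestructure.constrSet G {e | L.IsFormula e}) (I (.inl .exprFormula))
  I_mem : ∀ x y : Option D, (I (.inl .mem) : Option D → Option D → TV.{u}) x y =
    .of (∃ d d', x = some d ∧ y = some d' ∧ mem d d')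
  I_typeEqual : ∀ S S' : Set D, (I (.inl .typeEqual) : Set D → Set D → TV.{u}) S S' =
    .of (S = S')
  I_termEqual : ∀ (x y : Option D) (S : Set D),
    (I (.inl .termEqual) : Option D → Option D → Set D → TV.{u}) x y S =
      .of (∃ d ∈ S, x = some d ∧ y = some d)
  I_formulaEqual : ∀ p q : TV.{u}, (I (.inl .formulaEqual) : TV.{u} → TV.{u} → TV.{u}) p q =
    .of (p = q)
  I_not : ∀ p : TV.{u}, (I (.inl .not) : TV.{u} → TV.{u}) p = .of (p = .f)
  I_or : ∀ p q : TV.{u}, (I (.inl .or) : TV.{u} → TV.{u} → TV.{u}) p q = .of (p = .t ∨ q = .t)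


/-! ### Valuations -/

/-- The result of an undefined evaluation of kind `k`. -/
noncomputable def undefOfKind {D : Type u} {O : Type} : Expr O → Value D
  | .sym (.kw .type) => .type Set.univ
  | .sym (.kw .formula) => .formula .f
  | _ => .term none

namespace Structure

variable {L : Language} (S : Structure.{u} L)

open Classical in
/-- The clauses of the standard valuation, by recursion on the number of occurrences of `eval` that
are not within a quotation and, for the same number, on the size of the expression. -/
noncomputable def preVal : L.Ex → (Symbol → S.D) → Option (Value S.D)
  | .list (.sym (.kw .op) :: .opn o :: ks), φ =>
      some (.op (L.θ o)
        (Operation.restrict True (ks.map fun k => preVal k φ) (L.θ o).args (L.θ o).res (S.I o)))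
  | .list (.sym (.kw .opApp) :: O :: es), φ =>
      match preVal O φ with
      | some (.op F f) =>
          some (Dom.toValue F.res (Operation.apply F.args F.res f (es.map fun e => preVal e φ)))
      | _ => none
  | .list [.sym (.kw .var), .sym x, α], φ =>
      some (.term (if φ x ∈ Value.superclass (preVal α φ) then some (φ x) else none))
  | .list [.sym (.kw .typeApp), α, a], φ =>
      some (.type (S.typeApp (Value.superclass (preVal α φ)) (Value.cls (preVal a φ))))
  | .list [.sym (.kw .depFunType), .list [.sym (.kw .var), .sym x, α], β], φ =>
      some (.type {g | S.IsFunction g ∧ ∀ d y, S.IsSet d → S.app g d = some y →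
        d ∈ Value.superclass (preVal α φ) ∧ y ∈ Value.superclass (preVal β (upd φ x d))})
  | .list [.sym (.kw .funApp), f, a], φ =>
      some (.term ((Value.cls (preVal f φ)).bind fun g =>
        (Value.cls (preVal a φ)).bind fun x => S.app g x))
  | .list [.sym (.kw .funAbs), .list [.sym (.kw .var), .sym x, α], b], φ =>
      some (.term (if h : ∃ g, S.IsFunction g ∧ S.ext g =
          {p | ∃ d d', S.IsSet d ∧ d ∈ Value.superclass (preVal α φ) ∧
            Value.cls (preVal b (upd φ x d)) = some d' ∧ S.IsSet d' ∧ IsOPair S.mem p d d'}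
        then some h.choose else none))
  | .list [.sym (.kw .cond), A, b, c], φ =>
      if Value.IsTrue (preVal A φ) then preVal b φ else preVal c φ
  | .list [.sym (.kw .ex), .list [.sym (.kw .var), .sym x, α], B], φ =>
      some (.formula (.of (∃ d ∈ Value.superclass (preVal α φ),
        Value.IsTrue (preVal B (upd φ x d)))))
  | .list [.sym (.kw .defDes), .list [.sym (.kw .var), .sym x, α], B], φ =>
      some (.term (if h : ∃! d, d ∈ Value.superclass (preVal α φ) ∧
          Value.IsTrue (preVal B (upd φ x d)) then some h.choose else none))
  | .list [.sym (.kw .indefDes), .list [.sym (.kw .var), .sym x, α], B], φ =>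
      some (.term (if ∃ d, d ∈ Value.superclass (preVal α φ) ∧
          Value.IsTrue (preVal B (upd φ x d))
        then some (S.ξ {d | d ∈ Value.superclass (preVal α φ) ∧
          Value.IsTrue (preVal B (upd φ x d))}) else none))
  | .list [.sym (.kw .quote), e], _ => some (.term (some (S.constr S.G e)))
  | .list [.sym (.kw .eval), a, k], φ =>
      if h : ∃ e : L.Ex, Value.cls (preVal a φ) = some (S.constr S.G e) ∧ EvalFree e ∧
          ((L.IsType e ∧ k = key .type) ∨ (L.IsTerm e ∧ L.IsType k) ∨
            (L.IsFormula e ∧ k = key .formula)) then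
        if L.IsType k → ∃ d ∈ Value.superclass (preVal k φ),
            Value.cls (preVal h.choose φ) = some d
        then preVal h.choose φ else some (undefOfKind k)
      else some (undefOfKind k)
  | _, _ => none
termination_by e => (e.evalCount, sizeOf e)
decreasing_by
  all_goals first
    | (refine lex_of_mem ?_ rfl; simp [*]; done)
    | (refine lex_of_mem_mem (es := [_, _, _]) ?_ rfl (List.mem_cons_of_mem _
        List.mem_cons_self) rfl; simp)
    | (refine lex_of_evalFree (Exists.choose_spec (p := fun e => _ ∧ EvalFree e ∧ _) ?_).2.1; assumption)

open Classical in
/-- The standard valuation; `none` means that the value is undefined. -/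
noncomputable def val (e : L.Ex) (φ : Symbol → S.D) : Option (Value S.D) :=
  if L.IsProper e then S.preVal e φ else none

end Structure

namespace Language

variable (L : Language)

/-- `⊨ A`: the value of `A` is true in all standard models for `L`, i.e. for all structures for `L`
with their standard valuations, with respect to all assignments. -/
def Valid (A : L.Ex) : Prop :=
  ∀ (S : Structure.{u} L) (φ : Symbol → S.D), S.val A φ = some (.formula .t)

/-! ### The translation of NBG -/

/-- The translation of variables: `x` becomes `(x : C)`. -/
def Φvar (x : Symbol) : L.Ex := var x L.tyC

/-- The translation of formulas. -/
def Φ : NBGFormula → L.Ex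
  | .isSet x =>
      L.app .termEqual [L.tyC, L.tyC, key .type, key .formula] [L.Φvar x, L.Φvar x, L.tyV]
  | .eq x y =>
      L.app .termEqual [L.tyC, L.tyC, key .type, key .formula] [L.Φvar x, L.Φvar y, L.tyC]
  | .mem x y => L.app .mem [L.tyV, L.tyC, key .formula] [L.Φvar x, L.Φvar y]
  | .neg A => L.app .not [key .formula, key .formula] [Φ A]
  | .or A B => L.app .or [key .formula, key .formula, key .formula] [Φ A, Φ B]
  | .ex x A => .list [key .ex, var x L.tyC, Φ A]

/-- A translation from NBG to `L` maps variables to terms and formulas to formulas. -/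
def IsTranslation (Ψvar : Symbol → L.Ex) (Ψ : NBGFormula → L.Ex) : Prop :=
  (∀ x, L.IsTerm (Ψvar x)) ∧ ∀ A, L.IsFormula (Ψ A)

/-- A (semantic) interpretation of NBG in Chiron. -/
def IsInterpretation (Ψvar : Symbol → L.Ex) (Ψ : NBGFormula → L.Ex) : Prop :=
  L.IsTranslation Ψvar Ψ ∧ ∀ A, NBGValid.{u} A → Valid.{u} L (Ψ A)

/-- A faithful interpretation of NBG in Chiron. -/
def IsFaithfulInterpretation (Ψvar : Symbol → L.Ex) (Ψ : NBGFormula → L.Ex) : Prop :=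
  IsInterpretation.{u} L Ψvar Ψ ∧ ∀ A, Valid.{u} L (Ψ A) → NBGValid.{u} A

end Language

end Chiron

namespace Chiron
open Chiron.Expr

-- In every structure for `L`, the value of `Φ A` is the truth value of `A` in the membership
-- structure underlying it (`Structure.preVal_Φ`). The type `C` denotes the whole domain, so
-- variables of type `C` are always defined and quantifiers over `C` are unrestricted. The operator
-- for membership has kind `V` at its first place and is therefore false at proper classes, which
-- are members of nothing anyway. Since a structure contains a model of NBG, NBG-validity of `A`
-- gives validity of `Φ A`.
--
-- The converse requires enough structures. If `A` fails in a model of NBG, a structure for `L` is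
-- wanted on a model where it still fails. The obstacle is that the codes of the operator names must
-- form a class: `L` may have exactly countably many operator names, and nothing provides a
-- countably infinite class in an arbitrary model. By the downward Löwenheim–Skolem theorem
-- (`NBGModel.exists_countable`) the model may be replaced by a countable elementary submodel
-- containing the values of the assignment. There every infinite class is countable and can be
-- matched with the operator names.
--
-- The codes are sets having the empty set as a member; these are neither empty nor Kuratowski
-- pairs. They are divided according to whether they also contain the singleton of the empty set:
-- those that do form an infinite class, used for operator names, and infinitely many others remain
-- for the symbols (`Prestructure.exists_infinite_class_of_nonpairs`). The remaining requirements
-- can be met by definition (`Prestructure.exists_structure`); only the operator for terms of a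
-- given type needs an argument, namely that distinct expressions have distinct codes
-- (`Prestructure.constr_injective`).

theorem TV.of_eq_t {p : Prop} : TV.of.{u} p = .t ↔ p := by
  unfold TV.of; split_ifs <;> simp [*]

theorem TV.of_eq_f {p : Prop} : TV.of.{u} p = .f ↔ ¬ p := by
  unfold TV.of; split_ifs <;> simp [*]

-- Values of translated formulas

namespace Structure

variable {L : Language} (S : Structure.{u} L)

theorem superclass_preVal_tyC (φ : Symbol → S.D) :
    Value.superclass (S.preVal L.tyC φ) = Set.univ := by
  -- The first unfolding evaluates the operator application, the second the operator inside it.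
  rw [preVal, preVal]
  simp only [List.map, Language.θ, BuiltIn.sig, Operation.apply, Operation.restrict, Dom.toValue,
    Dom.InKind, and_self, Value.superclass]
  exact S.I_cls

theorem superclass_preVal_tyV (φ : Symbol → S.D) :
    Value.superclass (S.preVal L.tyV φ) = {x | S.IsSet x} := by
  rw [preVal, preVal]
  simp only [List.map, Language.θ, BuiltIn.sig, Operation.apply, Operation.restrict, Dom.toValue,
    Dom.InKind, and_self, Value.superclass]
  exact S.I_set

theorem preVal_Φvar (φ : Symbol → S.D) (x : Symbol) :
    S.preVal (L.Φvar x) φ = some (.term (some (φ x))) := by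
  rw [Language.Φvar, preVal, superclass_preVal_tyC]
  simp

/-- The application of equality in a type. -/
theorem preVal_termEqual (φ : Symbol → S.D) (a b α : L.Ex) :
    S.preVal (L.app .termEqual [L.tyC, L.tyC, key .type, key .formula] [a, b, α]) φ =
      some (.formula (.of (∃ d ∈ Value.superclass (S.preVal α φ),
        Value.cls (S.preVal a φ) = some d ∧ Value.cls (S.preVal b φ) = some d))) := by
  have h := S.I_termEqual (Value.cls (S.preVal a φ)) (Value.cls (S.preVal b φ))
    (Value.superclass (S.preVal α φ))
  rw [preVal, preVal]
  simp only [List.map, Language.θ, BuiltIn.sig, Operation.apply, Operation.restrict, Dom.toValue,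
    Dom.InKind, Value.toDom, List.head?_cons, List.tail_cons, Option.join_some,
    superclass_preVal_tyC, Set.mem_univ, implies_true, and_self]
  rw [← h]
  rfl

/-- The application of membership. -/
theorem preVal_mem (φ : Symbol → S.D) (a b : L.Ex) :
    S.preVal (L.app .mem [L.tyV, L.tyC, key .formula] [a, b]) φ =
      some (.formula (.of (∃ d d', Value.cls (S.preVal a φ) = some d ∧
        Value.cls (S.preVal b φ) = some d' ∧ S.mem d d'))) := by
  have h := S.I_mem (Value.cls (S.preVal a φ)) (Value.cls (S.preVal b φ))
  rw [preVal, preVal]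
  simp only [List.map, Language.θ, BuiltIn.sig, Operation.apply, Operation.restrict, Dom.toValue,
    Dom.InKind, Value.toDom, List.head?_cons, List.tail_cons, Option.join_some,
    superclass_preVal_tyC, superclass_preVal_tyV, Set.mem_univ, implies_true, and_true, true_and]
  refine congrArg (fun p => some (Value.formula p)) (Eq.trans ?_ h)
  -- The place of kind `V` makes the operator yield the undefined value F at a proper class. This
  -- agrees with membership, because whatever is a member of a class is a set.
  by_cases hs : ∀ x, Value.cls (S.preVal a φ) = some x → S.IsSet x
  · exact if_pos ⟨⟨⟨trivial, by rwa [superclass_preVal_tyV]⟩,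
      by simp [superclass_preVal_tyC]⟩, trivial⟩
  · refine (if_neg fun hc => hs fun x hx => ?_).trans (Eq.trans ?_ h.symm)
    · have := hc.1.1.2 x hx
      rwa [superclass_preVal_tyV] at this
    · refine (TV.of_eq_f.2 ?_).symm
      rintro ⟨d, d', h1, -, h3⟩
      refine hs fun x hx => ?_
      cases h1.symm.trans hx
      exact ⟨d', h3⟩

/-- The application of negation. -/
theorem preVal_not (φ : Symbol → S.D) (A : L.Ex) :
    S.preVal (L.app .not [key .formula, key .formula] [A]) φ =
      some (.formula (.of (Value.truth (S.preVal A φ) = .f))) := by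
  have h := S.I_not (Value.truth (S.preVal A φ))
  rw [preVal, preVal]
  simp only [List.map, Language.θ, BuiltIn.sig, Operation.apply, Operation.restrict, Dom.toValue,
    Dom.InKind, Value.toDom, List.head?_cons, Option.join_some, and_self]
  rw [← h]
  rfl

/-- The application of disjunction. -/
theorem preVal_or (φ : Symbol → S.D) (A B : L.Ex) :
    S.preVal (L.app .or [key .formula, key .formula, key .formula] [A, B]) φ =
      some (.formula (.of (Value.truth (S.preVal A φ) = .t ∨
        Value.truth (S.preVal B φ) = .t))) := by
  have h := S.I_or (Value.truth (S.preVal A φ)) (Value.truth (S.preVal B φ))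
  rw [preVal, preVal]
  simp only [List.map, Language.θ, BuiltIn.sig, Operation.apply, Operation.restrict, Dom.toValue,
    Dom.InKind, Value.toDom, List.head?_cons, List.tail_cons, Option.join_some, and_self]
  rw [← h]
  rfl

end Structure

/-- The model of NBG given by a prestructure. -/
def Prestructure.toNBGModel (P : Prestructure.{u}) : NBGModel.{u} where
  D := P.D
  nonempty := P.nonempty
  V := P.IsSet
  eq := Eq
  mem := P.mem
  eq_iff _ _ := Iff.rfl
  isNBG := P.isNBG

namespace Structure

variable {L : Language} (S : Structure.{u} L)

/-- The semantic core, by induction on `A`. Self-equality in `V` says that the value of the variable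
is a set, and since `C` denotes everything, the Chiron quantifier over `C` ranges over the same
domain as the first-order one. -/
theorem preVal_Φ (A : NBGFormula) (φ : Symbol → S.D) :
    S.preVal (L.Φ A) φ = some (.formula (.of (S.toNBGModel.Sat A φ))) := by
  induction A generalizing φ with
  | isSet x =>
    rw [Language.Φ, preVal_termEqual, preVal_Φvar, superclass_preVal_tyV]
    simp [Value.cls, NBGModel.Sat, Prestructure.toNBGModel]
  | eq x y =>
    rw [Language.Φ, preVal_termEqual, preVal_Φvar, preVal_Φvar, superclass_preVal_tyC]
    simp [Value.cls, NBGModel.Sat, Prestructure.toNBGModel, eq_comm]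
  | mem x y =>
    rw [Language.Φ, preVal_mem, preVal_Φvar, preVal_Φvar]
    simp [Value.cls, NBGModel.Sat, Prestructure.toNBGModel]
  | neg A ih =>
    rw [Language.Φ, preVal_not, ih]
    simp [Value.truth, NBGModel.Sat, TV.of_eq_f]
  | or A B ihA ihB =>
    rw [Language.Φ, preVal_or, ihA, ihB]
    simp [Value.truth, NBGModel.Sat, TV.of_eq_t]
  | ex x A ih =>
    rw [Language.Φ, preVal, superclass_preVal_tyC]
    simp only [ih, Value.IsTrue, Set.mem_univ, true_and, Option.some.injEq, Value.formula.injEq,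
      TV.of_eq_t]
    rfl

end Structure

-- Translated expressions are proper

namespace Language

variable (L : Language)

theorem isType_tyC : L.IsType L.tyC := by
  refine .opApp (.inl .cls) [] (key .type) [] (.op _ _ rfl ?_) rfl (by simp)
  -- The signature is checked place by place; beyond its end the lookup fails, which closes the last
  -- case.
  rintro (_ | i) s k h1 h2
  · cases h1; cases h2; exact .type
  · cases h1

theorem isType_tyV : L.IsType L.tyV := by
  refine .opApp (.inl .set) [] (key .type) [] (.op _ _ rfl ?_) rfl (by simp)
  rintro (_ | i) s k h1 h2
  · cases h1; cases h2; exact .type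
  · cases h1

theorem isTermOf_Φvar (x : Symbol) : L.IsTermOf (L.Φvar x) L.tyC :=
  ⟨.var x _ L.isType_tyC, L.isType_tyC⟩

theorem isFormula_termEqual {a b α : L.Ex} (ha : L.IsTerm a) (hb : L.IsTerm b)
    (hα : L.IsType α) :
    L.IsFormula (L.app .termEqual [L.tyC, L.tyC, key .type, key .formula] [a, b, α]) := by
  refine .opApp (.inl .termEqual) [L.tyC, L.tyC, key .type] (key .formula) _
    (.op _ _ rfl ?_) rfl ?_
  · rintro (_ | _ | _ | _ | i) s k h1 h2
    · cases h1; cases h2; exact .term _ L.isType_tyC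
    · cases h1; cases h2; exact .term _ L.isType_tyC
    · cases h1; cases h2; exact .type
    · cases h1; cases h2; exact .formula
    · cases h1
  · obtain ⟨σ, ha, hσ⟩ := ha
    obtain ⟨τ, hb, hτ⟩ := hb
    rintro (_ | _ | _ | i) k e h1 h2
    · cases h1; cases h2; exact .term _ _ _ L.isType_tyC ha hσ
    · cases h1; cases h2; exact .term _ _ _ L.isType_tyC hb hτ
    · cases h1; cases h2; exact .type _ hα
    · cases h1

/-- Needed also for the semantics: `Structure.val` gives improper expressions no value, so a
translation that was not proper could never be valid. -/
theorem isFormula_Φ (A : NBGFormula) : L.IsFormula (L.Φ A) := by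
  induction A with
  | isSet x => exact L.isFormula_termEqual ⟨_, L.isTermOf_Φvar x⟩ ⟨_, L.isTermOf_Φvar x⟩ L.isType_tyV
  | eq x y => exact L.isFormula_termEqual ⟨_, L.isTermOf_Φvar x⟩ ⟨_, L.isTermOf_Φvar y⟩ L.isType_tyC
  | mem x y =>
    refine .opApp (.inl .mem) [L.tyV, L.tyC] (key .formula) _ (.op _ _ rfl ?_) rfl ?_
    · rintro (_ | _ | _ | i) s k h1 h2
      · cases h1; cases h2; exact .term _ L.isType_tyV
      · cases h1; cases h2; exact .term _ L.isType_tyC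
      · cases h1; cases h2; exact .formula
      · cases h1
    · rintro (_ | _ | i) k e h1 h2
      · cases h1; cases h2; exact .term _ _ _ L.isType_tyV (L.isTermOf_Φvar x).1 L.isType_tyC
      · cases h1; cases h2; exact .term _ _ _ L.isType_tyC (L.isTermOf_Φvar y).1 L.isType_tyC
      · cases h1
  | neg A ih =>
    refine .opApp (.inl .not) [key .formula] (key .formula) _ (.op _ _ rfl ?_) rfl ?_
    · rintro (_ | _ | i) s k h1 h2
      · cases h1; cases h2; exact .formula
      · cases h1; cases h2; exact .formula
      · cases h1
    · rintro (_ | i) k e h1 h2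
      · cases h1; cases h2; exact .formula _ ih
      · cases h1
  | or A B ihA ihB =>
    refine .opApp (.inl .or) [key .formula, key .formula] (key .formula) _ (.op _ _ rfl ?_) rfl ?_
    · rintro (_ | _ | _ | i) s k h1 h2
      · cases h1; cases h2; exact .formula
      · cases h1; cases h2; exact .formula
      · cases h1; cases h2; exact .formula
      · cases h1
    · rintro (_ | _ | i) k e h1 h2
      · cases h1; cases h2; exact .formula _ ihA
      · cases h1; cases h2; exact .formula _ ihB
      · cases h1
  | ex x A ih => exact .ex _ _ _ L.isType_tyC ih

theorem isTranslation_Φ : L.IsTranslation L.Φvar L.Φ :=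
  ⟨fun x => ⟨_, L.isTermOf_Φvar x⟩, L.isFormula_Φ⟩

end Language

theorem Structure.val_Φ_eq_true_iff {L : Language} (S : Structure.{u} L) (A : NBGFormula)
    (φ : Symbol → S.D) :
    S.val (L.Φ A) φ = some (.formula .t) ↔ S.toNBGModel.Sat A φ := by
  rw [Structure.val, if_pos ⟨_, L.isFormula_Φ A⟩, S.preVal_Φ]
  simp [TV.of_eq_t]

-- Elementary set theory inside a model of NBG

namespace Prestructure

variable (P : Prestructure.{u})

variable {P} in
theorem eq_of_forall_mem_iff {x y : P.D} (h : ∀ z, P.mem z x ↔ P.mem z y) : x = y :=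
  P.isNBG.extensionality x y fun z _ => h z

theorem exists_empty : ∃ x, P.IsSet x ∧ ∀ z, ¬ P.mem z x := by
  obtain ⟨a, ha, -⟩ := P.isNBG.infinity
  obtain ⟨c, hc⟩ := P.isNBG.complement a
  obtain ⟨i, hi⟩ := P.isNBG.intersection a c
  have h0 : ∀ z, ¬ P.mem z i := fun z hz => by
    have h := (hi z ⟨i, hz⟩).1 hz
    exact (hc z ⟨i, hz⟩).1 h.2 h.1
  -- The empty class is vacuously univocal, so by replacement the image of the set `a` under it is a
  -- set, and this image is empty.
  obtain ⟨r, hr, h⟩ := P.isNBG.replacement i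
    (fun _ _ _ _ _ _ ⟨p, _, hp⟩ => absurd hp (h0 p)) a ha
  refine ⟨r, hr, fun z hz => ?_⟩
  obtain ⟨s, -, -, p, -, hp⟩ := (h z ⟨r, hz⟩).1 hz
  exact h0 p hp

theorem not_mem_empty (z : P.D) : ¬ P.mem z P.empty := by
  have h : ∃ x, ∀ z, ¬ P.mem z x := P.exists_empty.imp fun _ h => h.2
  exact @Classical.epsilon_spec_aux _ P.nonempty (fun x => ∀ z, ¬ P.mem z x) h z

theorem isSet_empty : P.IsSet P.empty := by
  obtain ⟨x, hx, h⟩ := P.exists_empty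
  rwa [show P.empty = x from eq_of_forall_mem_iff fun z =>
    iff_of_false (P.not_mem_empty z) (h z)]

variable {P}

theorem isOPair_opair {x y : P.D} (hx : P.IsSet x) (hy : P.IsSet y) :
    IsOPair P.mem (P.opair x y) x y ∧ P.IsSet (P.opair x y) := by
  obtain ⟨s, hs, hs'⟩ := P.isNBG.pairing x x hx hx
  obtain ⟨t, ht, ht'⟩ := P.isNBG.pairing x y hx hy
  obtain ⟨p, hp, hp'⟩ := P.isNBG.pairing s t hs ht
  have h : IsOPair P.mem (P.opair x y) x y :=
    @Classical.epsilon_spec_aux _ P.nonempty (fun p => IsOPair P.mem p x y)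
      ⟨p, s, t, hs', ht', hp'⟩
  refine ⟨h, ?_⟩
  obtain ⟨s', t', h1, h2, h3⟩ := h
  -- The pair picked by `epsilon` is known only by its members; extensionality identifies it with
  -- the one built by the pairing axiom, which is a set.
  obtain rfl : s' = s := eq_of_forall_mem_iff fun z => (h1 z).trans (hs' z).symm
  obtain rfl : t' = t := eq_of_forall_mem_iff fun z => (h2 z).trans (ht' z).symm
  rwa [show P.opair x y = p from eq_of_forall_mem_iff fun z => (h3 z).trans (hp' z).symm]

theorem _root_.Chiron.IsUPair.eq_or_eq {D : Type u} {mem : D → D → Prop} {w a b c d : D}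
    (h : IsUPair mem w a b) (h' : IsUPair mem w c d) : (a = c ∧ b = d) ∨ (a = d ∧ b = c) := by
  have h1 := (h' a).1 ((h a).2 (.inl rfl))
  have h2 := (h' b).1 ((h b).2 (.inr rfl))
  have h3 := (h c).1 ((h' c).2 (.inl rfl))
  have h4 := (h d).1 ((h' d).2 (.inr rfl))
  grind

theorem _root_.Chiron.IsOPair.inj {D : Type u} {mem : D → D → Prop} {p a b c d : D}
    (h : IsOPair mem p a b) (h' : IsOPair mem p c d) : a = c ∧ b = d := by
  obtain ⟨s, t, hs, ht, hp⟩ := h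
  obtain ⟨s', t', hs', ht', hp'⟩ := h'
  rcases hp.eq_or_eq hp' with ⟨rfl, rfl⟩ | ⟨rfl, rfl⟩
  · have := hs.eq_or_eq hs'
    have := ht.eq_or_eq ht'
    grind
  · have := hs.eq_or_eq ht'
    have := ht.eq_or_eq hs'
    grind

theorem pairMem_iff {a b x : P.D} (ha : P.IsSet a) (hb : P.IsSet b)  :
    PairMem P.mem a b x ↔ P.mem (P.opair a b) x := by
  refine ⟨?_, fun h => ⟨_, (isOPair_opair ha hb).1, h⟩⟩
  rintro ⟨p, ⟨s, t, hs, ht, hp⟩, h⟩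
  obtain ⟨s', t', hs', ht', hp'⟩ := (isOPair_opair ha hb).1
  obtain rfl : s' = s := eq_of_forall_mem_iff fun z => (hs' z).trans (hs z).symm
  obtain rfl : t' = t := eq_of_forall_mem_iff fun z => (ht' z).trans (ht z).symm
  rwa [show P.opair a b = p from eq_of_forall_mem_iff fun z => (hp' z).trans (hp z).symm]

/-- The class of all sets that contain a given set. -/
theorem exists_class_contains {c : P.D} (hc : P.IsSet c) :
    ∃ z, ∀ a, P.mem a z ↔ P.IsSet a ∧ P.mem c a := by
  -- Comprehension is obtained from Gödel's operations: the relation `∈` is cut down to first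
  -- component `c` by the cylinder over `{c}`, then converted, and its domain is taken. Members of
  -- these classes that are not pairs are irrelevant.
  obtain ⟨e, he⟩ := P.isNBG.membership
  obtain ⟨s, -, hs⟩ := P.isNBG.pairing c c hc hc
  obtain ⟨y, hy⟩ := P.isNBG.cylinder s
  obtain ⟨i, hi⟩ := P.isNBG.intersection e y
  obtain ⟨j, hj⟩ := P.isNBG.converse i
  obtain ⟨z, hz⟩ := P.isNBG.domain j
  have key : ∀ a, P.IsSet a → (P.mem a z ↔ P.mem c a) := by
    intro a ha
    have hb : ∀ b, P.IsSet b → (PairMem P.mem a b j ↔ P.mem b a ∧ b = c) := by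
      intro b hb
      rw [hj a b ha hb, pairMem_iff hb ha, hi _ (isOPair_opair hb ha).2, ← pairMem_iff hb ha,
        ← pairMem_iff hb ha, he b a hb ha, hy b a hb ha, hs b, or_self]
    rw [hz a ha]
    constructor
    · rintro ⟨b, hb1, hb2⟩
      obtain ⟨h, rfl⟩ := (hb b hb1).1 hb2
      exact h
    · exact fun h => ⟨c, hc, (hb c hc).2 ⟨h, rfl⟩⟩
  exact ⟨z, fun a => ⟨fun h => ⟨⟨z, h⟩, (key a ⟨z, h⟩).1 h⟩, fun h => (key a h.1).2 h.2⟩⟩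

/-- `a ∪ {b}` is a set. -/
theorem exists_insert {a b : P.D} (ha : P.IsSet a) (hb : P.IsSet b) :
    ∃ z, P.IsSet z ∧ ∀ t, P.mem t z ↔ P.mem t a ∨ t = b := by
  -- The witness is the union of `{a, {b}}`.
  obtain ⟨s, hs, hs'⟩ := P.isNBG.pairing b b hb hb
  obtain ⟨w, hw, hw'⟩ := P.isNBG.pairing a s ha hs
  obtain ⟨z, hz, hz'⟩ := P.isNBG.sum w hw
  have key : ∀ t, P.IsSet t → (P.mem t z ↔ P.mem t a ∨ t = b) := by
    intro t ht
    rw [hz' t ht]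
    constructor
    · rintro ⟨c, h1, h2⟩
      rcases (hw' c).1 h2 with rfl | rfl
      · exact .inl h1
      · exact .inr (by simpa using (hs' t).1 h1)
    · rintro (h | h)
      · exact ⟨a, h, (hw' a).2 (.inl rfl)⟩
      · exact ⟨s, (hs' t).2 (.inl h), (hw' s).2 (.inr rfl)⟩
  refine ⟨z, hz, fun t => ⟨fun h => (key t ⟨z, h⟩).1 h, fun h => (key t ?_).2 h⟩⟩
  rcases h with h | rfl
  · exact ⟨a, h⟩
  · exact hb

/-- Finiteness is meant externally, so members can be inserted one at a time. This makes the codes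
of finitely many operator names a class. -/
theorem exists_ext_eq_of_finite {T : Set P.D} (hT : T.Finite) (h : ∀ x ∈ T, P.IsSet x) :
    ∃ c, P.IsSet c ∧ P.ext c = T := by
  induction T, hT using Set.Finite.induction_on with
  | empty => exact ⟨P.empty, P.isSet_empty, Set.eq_empty_of_forall_notMem P.not_mem_empty⟩
  | @insert a T _ _ ih =>
    obtain ⟨c, hc, rfl⟩ := ih fun x hx => h x (.inr hx)
    obtain ⟨z, hz, hz'⟩ := exists_insert hc (h a (.inl rfl))
    exact ⟨z, hz, Set.ext fun t => (hz' t).trans or_comm⟩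

variable (P) in
-- The axiom of infinity gives a nonempty set no member of which is maximal under inclusion, whereas
-- a nonempty finite family has a maximal member.
theorem infinite_isSet : {x | P.IsSet x}.Infinite := by
  obtain ⟨a, -, hne, hmax⟩ := P.isNBG.infinity
  intro hfin
  have hfin' : (P.ext '' P.ext a).Finite :=
    (hfin.subset fun x hx => (⟨a, hx⟩ : P.IsSet x)).image _
  obtain ⟨m, hm⟩ := hfin'.exists_maximal (Set.Nonempty.image _ hne)
  obtain ⟨b, hb, rfl⟩ := hm.prop
  obtain ⟨c, hc, hbc, hne⟩ := hmax b hb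
  exact hne (eq_of_forall_mem_iff fun z => ⟨hbc z, fun hz =>
    hm.le_of_ge (Set.mem_image_of_mem _ hc) hbc hz⟩)

/-- Infinitely many sets `x` lie outside `F`, and since `F` covers `a`, distinct such `x` give
distinct sets `a ∪ {x}`. Allowing `F` to be larger than `a` makes it possible to keep further sets
out of `a ∪ {x}`. -/
theorem infinite_insert {a : P.D} (ha : P.IsSet a) {F : Set P.D} (hF : F.Finite)
    (haF : P.ext a ⊆ F) :
    {z | P.IsSet z ∧ ∃ x ∉ F, ∀ t, P.mem t z ↔ P.mem t a ∨ t = x}.Infinite := by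
  have hinf := P.infinite_isSet.sdiff hF
  choose! f hf hf' using fun x (hx : P.IsSet x) => exists_insert ha hx
  refine (hinf.image (f := f) ?_).mono ?_
  · rintro x ⟨hx, hxF⟩ y ⟨hy, hyF⟩ hxy
    have h1 := (hf' x hx x).2 (.inr rfl)
    rw [hxy, hf' y hy] at h1
    exact h1.resolve_left fun h => hxF (haF h)
  · rintro _ ⟨x, ⟨hx, hxF⟩, rfl⟩
    exact ⟨hf x hx, x, hxF, hf' x hx⟩

/-- Both members `{x}` and `{x, y}` of a Kuratowski pair are nonempty. Sets containing the empty set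
can thus serve as codes of atomic expressions. -/
theorem not_isOPair_of_empty_mem {p : P.D} (h : P.mem P.empty p) (x y : P.D) :
    ¬ IsOPair P.mem p x y := by
  rintro ⟨s, t, hs, ht, hp⟩
  rcases (hp _).1 h with rfl | rfl
  · exact P.not_mem_empty x ((hs x).2 (.inl rfl))
  · exact P.not_mem_empty x ((ht x).2 (.inl rfl))

variable (P) in
/-- There are an infinite class of sets and an infinite collection of other sets, none of them
empty or an ordered pair. -/
theorem exists_infinite_class_of_nonpairs : ∃ (k : P.D) (T : Set P.D), (P.ext k).Infinite ∧
    T.Infinite ∧ Disjoint (P.ext k) T ∧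
    (∀ x ∈ P.ext k, P.mem P.empty x) ∧ ∀ x ∈ T, P.IsSet x ∧ P.mem P.empty x := by
  -- With `c = {∅}` and `d = {∅, c}`, the class `k` consists of the sets containing both `∅` and
  -- `c`, and `T` of the sets containing `∅` but not `c`. Only `k` has to be a class, as the codes
  -- of symbols are not required to form one.
  obtain ⟨c, hc, hc'⟩ := P.isNBG.pairing P.empty P.empty P.isSet_empty P.isSet_empty
  have hne : P.empty ≠ c := fun h => by
    have := (hc' P.empty).2 (.inl rfl)
    rw [← h] at this
    exact P.not_mem_empty _ this
  obtain ⟨d, hd, hd'⟩ := P.isNBG.pairing P.empty c P.isSet_empty hc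
  obtain ⟨y, hy⟩ := exists_class_contains P.isSet_empty
  obtain ⟨z, hz⟩ := exists_class_contains hc
  obtain ⟨k, hk⟩ := P.isNBG.intersection y z
  have hk' : ∀ a, P.mem a k ↔ P.IsSet a ∧ P.mem P.empty a ∧ P.mem c a := by
    intro a
    constructor
    · intro h
      have := (hk a ⟨k, h⟩).1 h
      exact ⟨⟨k, h⟩, ((hy a).1 this.1).2, ((hz a).1 this.2).2⟩
    · rintro ⟨h, h1, h2⟩
      exact (hk a h).2 ⟨(hy a).2 ⟨h, h1⟩, (hz a).2 ⟨h, h2⟩⟩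
  have hF : ({P.empty, c} : Set P.D).Finite := Set.toFinite _
  refine ⟨k, {x | P.IsSet x ∧ P.mem P.empty x ∧ ¬ P.mem c x}, ?_, ?_, ?_, ?_, ?_⟩
  · refine (infinite_insert hd hF fun x hx => (hd' x).1 hx).mono ?_
    rintro w ⟨hw, x, hx, h⟩
    exact (hk' w).2 ⟨hw, (h _).2 (.inl ((hd' _).2 (.inl rfl))),
      (h _).2 (.inl ((hd' _).2 (.inr rfl)))⟩
  · refine (infinite_insert hc hF fun x hx => .inl (by simpa using (hc' x).1 hx)).mono ?_
    rintro w ⟨hw, x, hx, h⟩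
    refine ⟨hw, (h _).2 (.inl ((hc' _).2 (.inl rfl))), fun hcw => ?_⟩
    rcases (h c).1 hcw with h | rfl
    · exact hne.symm (by simpa using (hc' c).1 h)
    · exact hx (.inr rfl)
  · exact Set.disjoint_left.2 fun x hx hx' => hx'.2.2 ((hk' x).1 hx).2.2
  · exact fun x hx => ((hk' x).1 hx).2.1
  · exact fun x hx => ⟨hx.1, hx.2.1⟩

-- Distinct expressions have distinct codes

section Constructions

variable {O : Type} {G : Symbol ⊕ O → P.D}

mutual

theorem isSet_constr (hset : ∀ a, P.IsSet (G a)) : ∀ e : Expr O, P.IsSet (P.constr G e)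
  | .sym s => by rw [constr]; exact hset _
  | .opn o => by rw [constr]; exact hset _
  | .list es => by rw [constr]; exact isSet_constrList hset es

theorem isSet_constrList (hset : ∀ a, P.IsSet (G a)) :
    ∀ es : List (Expr O), P.IsSet (P.constrList G es)
  | [] => by rw [constrList]; exact P.isSet_empty
  | e :: es => by
    rw [constrList]; exact (isOPair_opair (isSet_constr hset e) (isSet_constrList hset es)).2

end

/-- A list is coded by the empty set or by an ordered pair, and the codes of atoms are neither. -/
theorem ne_constrList (hset : ∀ a, P.IsSet (G a))
    (hne : ∀ a, ∃ z, P.mem z (G a)) (hpair : ∀ a x y, ¬ IsOPair P.mem (G a) x y)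
    (a : Symbol ⊕ O) (es : List (Expr O)) : G a ≠ P.constrList G es := by
  intro h
  cases es with
  | nil =>
    obtain ⟨z, hz⟩ := hne a
    rw [h, constrList] at hz
    exact P.not_mem_empty z hz
  | cons e es =>
    rw [constrList] at h
    apply hpair a _ _
    rw [h]
    exact (isOPair_opair (isSet_constr hset e) (isSet_constrList hset es)).1

mutual

/-- Atoms are separated from lists by `ne_constrList`, from each other by injectivity of `G`, and
lists are compared entry by entry by the characteristic property of ordered pairs. This makes the
operator for terms of a given type well defined as a function of the code of the type. -/
theorem constr_injective (hinj : Function.Injective G) (hset : ∀ a, P.IsSet (G a))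
    (hne : ∀ a, ∃ z, P.mem z (G a)) (hpair : ∀ a x y, ¬ IsOPair P.mem (G a) x y) :
    ∀ e e' : Expr O, P.constr G e = P.constr G e' → e = e'
  | .sym s, .sym s', h => by simp only [constr] at h; cases hinj h; rfl
  | .opn s, .opn s', h => by simp only [constr] at h; cases hinj h; rfl
  | .sym s, .opn s', h => by simp only [constr] at h; cases hinj h
  | .opn s, .sym s', h => by simp only [constr] at h; cases hinj h
  | .list es, .sym s, h => by
    simp only [constr] at h; exact absurd h.symm (ne_constrList hset hne hpair _ _)
  | .list es, .opn s, h => by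
    simp only [constr] at h; exact absurd h.symm (ne_constrList hset hne hpair _ _)
  | .sym s, .list es, h => by
    simp only [constr] at h; exact absurd h (ne_constrList hset hne hpair _ _)
  | .opn s, .list es, h => by
    simp only [constr] at h; exact absurd h (ne_constrList hset hne hpair _ _)
  | .list es, .list es', h => by
    simp only [constr] at h; rw [constrList_injective hinj hset hne hpair es es' h]

theorem constrList_injective (hinj : Function.Injective G) (hset : ∀ a, P.IsSet (G a))
    (hne : ∀ a, ∃ z, P.mem z (G a)) (hpair : ∀ a x y, ¬ IsOPair P.mem (G a) x y) :
    ∀ es es' : List (Expr O), P.constrList G es = P.constrList G es' → es = es'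
  | [], [], _ => rfl
  | [], e :: es, h => by
    have hp := (isOPair_opair (isSet_constr hset e) (isSet_constrList hset es)).1
    simp only [constrList] at h
    obtain ⟨s, t, -, -, hp⟩ := hp
    exact absurd ((hp s).2 (.inl rfl)) (h ▸ P.not_mem_empty s)
  | e :: es, [], h => by
    have hp := (isOPair_opair (isSet_constr hset e) (isSet_constrList hset es)).1
    simp only [constrList] at h
    obtain ⟨s, t, -, -, hp⟩ := hp
    exact absurd ((hp s).2 (.inl rfl)) (h ▸ P.not_mem_empty s)
  | e :: es, e' :: es', h => by
    have hp := (isOPair_opair (isSet_constr hset e) (isSet_constrList hset es)).1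
    have hp' := (isOPair_opair (isSet_constr hset e') (isSet_constrList hset es')).1
    simp only [constrList] at h
    rw [← h] at hp'
    obtain ⟨h1, h2⟩ := hp.inj hp'
    rw [constr_injective hinj hset hne hpair e e' h1, constrList_injective hinj hset hne hpair es es' h2]

end

end Constructions

end Prestructure

-- First-order axiomatization and the Löwenheim–Skolem theorem

section FirstOrder

open FirstOrder FirstOrder.Language

/-- The relation symbols of the first-order language of set theory. -/
inductive MemRel : ℕ → Type
  | mem : MemRel 2

/-- The first-order language of set theory. -/
def memLanguage : FirstOrder.Language.{0, 0} := ⟨fun _ => Empty, MemRel⟩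

/-- The membership symbol. -/
def memSymbol : memLanguage.Relations 2 := MemRel.mem

/-- This and the next instance show that there are only countably many symbols, as the
Löwenheim–Skolem theorem demands for a countable submodel. -/
instance (n : ℕ) : Subsingleton (memLanguage.Relations n) :=
  ⟨fun r s => by cases r; cases s; rfl⟩

instance (n : ℕ) : IsEmpty (memLanguage.Functions n) := inferInstanceAs (IsEmpty Empty)

theorem card_memLanguage_le : memLanguage.card ≤ Cardinal.aleph0 := by
  have : Countable memLanguage.Symbols := inferInstanceAs
    (Countable ((Σ n, memLanguage.Functions n) ⊕ Σ n, memLanguage.Relations n))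
  exact Cardinal.mk_le_aleph0

/-- The first-order structure given by a membership relation. -/
@[reducible] def memStructure {D : Type u} (mem : D → D → Prop) : memLanguage.Structure D where
  funMap f := nomatch f
  RelMap | .mem, v => mem (v 0) (v 1)

/-- The interpretation of membership in a first-order structure. -/
def relMem (M : Type u) [memLanguage.Structure M] (x y : M) : Prop :=
  Structure.RelMap memSymbol ![x, y]

namespace MemFormula

variable {α : Type} {n : ℕ}

/-- `xᵢ ∈ xⱼ`. -/
def mem (i j : Fin n) : memLanguage.BoundedFormula α n :=
  Relations.boundedFormula₂ memSymbol (.var (.inr i)) (.var (.inr j))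

/-- `xᵢ = xⱼ`. -/
def eq (i j : Fin n) : memLanguage.BoundedFormula α n :=
  Term.bdEqual (.var (.inr i)) (.var (.inr j))

/-- `xᵢ` is a set. -/
def isSet (i : Fin n) : memLanguage.BoundedFormula α n := ∃' mem i.castSucc (Fin.last n)

/-- `w` is the unordered pair `{a, b}`. -/
def upair (w a b : Fin n) : memLanguage.BoundedFormula α n :=
  ∀' (mem (Fin.last n) w.castSucc ⇔ (eq (Fin.last n) a.castSucc ⊔ eq (Fin.last n) b.castSucc))

/-- `p` is the ordered pair `⟨a, b⟩`. -/
def opair (p a b : Fin n) : memLanguage.BoundedFormula α n :=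
  ∃' ∃' (upair (Fin.last n).castSucc a.castSucc.castSucc a.castSucc.castSucc ⊓
    (upair (Fin.last _) a.castSucc.castSucc b.castSucc.castSucc ⊓
      upair p.castSucc.castSucc (Fin.last n).castSucc (Fin.last _)))

/-- `⟨a, b⟩ ∈ x`. -/
def pairMem (a b x : Fin n) : memLanguage.BoundedFormula α n :=
  ∃' (opair (Fin.last n) a.castSucc b.castSucc ⊓ mem (Fin.last n) x.castSucc)

/-- `⟨a, b, c⟩ ∈ x`. -/
def tripleMem (a b c x : Fin n) : memLanguage.BoundedFormula α n :=
  ∃' ∃' (opair (Fin.last n).castSucc b.castSucc.castSucc c.castSucc.castSucc ⊓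
    (opair (Fin.last _) a.castSucc.castSucc (Fin.last n).castSucc ⊓
      mem (Fin.last _) x.castSucc.castSucc))

variable {M : Type u} [memLanguage.Structure M] {v : α → M} {xs : Fin n → M}

theorem realize_mem {i j : Fin n} :
    (mem i j : memLanguage.BoundedFormula α n).Realize v xs ↔ relMem M (xs i) (xs j) := by
  simp [mem, relMem, BoundedFormula.realize_rel₂]

theorem realize_eq {i j : Fin n} :
    (eq i j : memLanguage.BoundedFormula α n).Realize v xs ↔ xs i = xs j := by
  simp [eq]

theorem realize_isSet {i : Fin n} :
    (isSet i : memLanguage.BoundedFormula α n).Realize v xs ↔ ∃ y, relMem M (xs i) y := by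
  simp [isSet, realize_mem]

theorem realize_upair {w a b : Fin n} :
    (upair w a b : memLanguage.BoundedFormula α n).Realize v xs ↔
      IsUPair (relMem M) (xs w) (xs a) (xs b) := by
  simp [upair, realize_mem, realize_eq, IsUPair]

theorem realize_opair {p a b : Fin n} :
    (opair p a b : memLanguage.BoundedFormula α n).Realize v xs ↔
      IsOPair (relMem M) (xs p) (xs a) (xs b) := by
  simp [opair, realize_upair, IsOPair]

theorem realize_pairMem {a b x : Fin n} :
    (pairMem a b x : memLanguage.BoundedFormula α n).Realize v xs ↔
      PairMem (relMem M) (xs a) (xs b) (xs x) := by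
  simp [pairMem, realize_opair, realize_mem, PairMem]

theorem realize_tripleMem {a b c x : Fin n} :
    (tripleMem a b c x : memLanguage.BoundedFormula α n).Realize v xs ↔
      TripleMem (relMem M) (xs a) (xs b) (xs c) (xs x) := by
  simp [tripleMem, realize_opair, realize_mem, TripleMem]

/-- The conjunction of the axioms of NBG. -/
def nbg : memLanguage.Sentence :=
  -- Numerals number the quantified variables from the outermost inwards. No conjunct corresponds to
  -- `V_iff`, because `isSet` is defined by membership.
  (∀' ∀' ((∀' (isSet 2 ⟹ (mem 2 0 ⇔ mem 2 1))) ⟹ eq 0 1)) ⊓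
  ((∀' ∀' (isSet 0 ⟹ isSet 1 ⟹ ∃' (isSet 2 ⊓ upair 2 0 1))) ⊓
  ((∃' ∀' ∀' (isSet 1 ⟹ isSet 2 ⟹ (pairMem 1 2 0 ⇔ mem 1 2))) ⊓
  ((∀' ∀' ∃' ∀' (isSet 3 ⟹ (mem 3 2 ⇔ (mem 3 0 ⊓ mem 3 1)))) ⊓
  ((∀' ∃' ∀' (isSet 2 ⟹ (mem 2 1 ⇔ ∼(mem 2 0)))) ⊓
  ((∀' ∃' ∀' (isSet 2 ⟹ (mem 2 1 ⇔ ∃' (isSet 3 ⊓ pairMem 2 3 0)))) ⊓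
  ((∀' ∃' ∀' ∀' (isSet 2 ⟹ isSet 3 ⟹ (pairMem 2 3 1 ⇔ mem 2 0))) ⊓
  ((∀' ∃' ∀' ∀' (isSet 2 ⟹ isSet 3 ⟹ (pairMem 2 3 1 ⇔ pairMem 3 2 0))) ⊓
  ((∀' ∃' ∀' ∀' ∀' (isSet 2 ⟹ isSet 3 ⟹ isSet 4 ⟹
    (tripleMem 2 3 4 1 ⇔ tripleMem 3 4 2 0))) ⊓
  ((∀' ∃' ∀' ∀' ∀' (isSet 2 ⟹ isSet 3 ⟹ isSet 4 ⟹
    (tripleMem 2 3 4 1 ⇔ tripleMem 2 4 3 0))) ⊓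
  ((∃' (isSet 0 ⊓ ((∃' mem 1 0) ⊓
    ∀' (mem 1 0 ⟹ ∃' (mem 2 0 ⊓ ((∀' (mem 3 1 ⟹ mem 3 2)) ⊓ ∼(eq 1 2))))))) ⊓
  ((∀' (isSet 0 ⟹ ∃' (isSet 1 ⊓ ∀' (isSet 2 ⟹
    (mem 2 1 ⇔ ∃' (mem 2 3 ⊓ mem 3 0)))))) ⊓
  ((∀' (isSet 0 ⟹ ∃' (isSet 1 ⊓ ∀' (isSet 2 ⟹
    (mem 2 1 ⇔ ∀' (mem 3 2 ⟹ mem 3 0)))))) ⊓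
  ((∀' ((∀' ∀' ∀' (isSet 1 ⟹ isSet 2 ⟹ isSet 3 ⟹ pairMem 1 2 0 ⟹ pairMem 1 3 0 ⟹ eq 2 3)) ⟹
    ∀' (isSet 1 ⟹ ∃' (isSet 2 ⊓ ∀' (isSet 3 ⟹
      (mem 3 2 ⇔ ∃' (isSet 4 ⊓ (mem 4 1 ⊓ pairMem 4 3 0)))))))) ⊓
  ((∀' ((∃' mem 1 0) ⟹ ∃' (mem 1 0 ⊓ ∀' ∼(mem 2 1 ⊓ mem 2 0)))) ⊓
  (∃' ((∀' (mem 1 0 ⟹ ∃' ∃' (isSet 2 ⊓ (isSet 3 ⊓ opair 1 2 3)))) ⊓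
    ((∀' ∀' ∀' (isSet 1 ⟹ isSet 2 ⟹ isSet 3 ⟹ pairMem 1 2 0 ⟹ pairMem 1 3 0 ⟹ eq 2 3)) ⊓
    ∀' (isSet 1 ⟹ (∃' mem 2 1) ⟹ ∃' (mem 2 1 ⊓ pairMem 1 2 0)))))))))))))))))))

variable (M) in
theorem realize_nbg :
    M ⊨ nbg ↔ IsNBG (fun x => ∃ y, relMem M x y) (relMem M) := by
  simp only [nbg, Sentence.Realize, Formula.Realize, BoundedFormula.realize_inf,
    BoundedFormula.realize_all, BoundedFormula.realize_ex, BoundedFormula.realize_imp,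
    BoundedFormula.realize_iff, BoundedFormula.realize_not, realize_mem, realize_eq,
    realize_isSet, realize_upair, realize_opair, realize_pairMem, realize_tripleMem]
  constructor
  · rintro ⟨h1, h2, h3, h4, h5, h6, h7, h8, h9, h10, h11, h12, h13, h14, h15, h16⟩
    exact ⟨fun _ => Iff.rfl, h1, h2, h3, h4, h5, h6, h7, h8, h9, h10, h11, h12, h13, h14, h15, h16⟩
  · rintro ⟨-, h1, h2, h3, h4, h5, h6, h7, h8, h9, h10, h11, h12, h13, h14, h15, h16⟩
    exact ⟨h1, h2, h3, h4, h5, h6, h7, h8, h9, h10, h11, h12, h13, h14, h15, h16⟩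

open Classical in
/-- The formulas of NBG as formulas of first-order set theory. -/
noncomputable def ofNBGFormula : NBGFormula → memLanguage.Formula Symbol
  | .isSet x => ∃' Relations.boundedFormula₂ memSymbol (.var (.inl x))
      (.var (.inr 0))
  | .eq x y => Term.bdEqual (.var (.inl x)) (.var (.inl y))
  | .mem x y => Relations.boundedFormula₂ memSymbol (.var (.inl x))
      (.var (.inl y))
  | .neg A => ∼(ofNBGFormula A)
  | .or A B => ofNBGFormula A ⊔ ofNBGFormula B
  -- Named variables are turned into bound ones: every free occurrence of `x` becomes the variable
  -- bound by the new quantifier.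
  | .ex x A => ∃' (BoundedFormula.relabel (n := 1) (k := 0)
      (fun y => if y = x then .inr 0 else .inl y) (ofNBGFormula A))

theorem realize_ofNBGFormula (N : NBGModel.{u}) [memLanguage.Structure N.D]
    (hN : relMem N.D = N.mem) (A : NBGFormula) (φ : Symbol → N.D) :
    (ofNBGFormula A).Realize φ ↔ N.Sat A φ := by
  induction A generalizing φ with
  | isSet x =>
    simp only [ofNBGFormula, NBGModel.Sat, N.isNBG.V_iff, ← hN]
    simp [Formula.Realize, BoundedFormula.realize_rel₂, relMem, Fin.snoc]
  | eq x y =>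
    simp only [ofNBGFormula, NBGModel.Sat, N.eq_iff]
    simp [Formula.Realize]
  | mem x y =>
    simp only [ofNBGFormula, NBGModel.Sat, ← hN]
    simp [Formula.Realize, BoundedFormula.realize_rel₂, relMem]
  | neg A ih => simp [ofNBGFormula, NBGModel.Sat, ih]
  | or A B ihA ihB => simp [ofNBGFormula, NBGModel.Sat, ihA, ihB]
  | ex x A ih =>
    simp only [ofNBGFormula, NBGModel.Sat, Formula.Realize, BoundedFormula.realize_ex]
    refine exists_congr fun d => ?_
    rw [← ih, BoundedFormula.realize_relabel, Formula.Realize]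
    -- After relabelling, the assignment of free variables is `upd φ x d`; no bound variables
    -- remain, so the other assignments are functions on an empty type and agree.
    refine iff_of_eq (congrArg₂ _ (funext fun y => ?_) (Subsingleton.elim _ _))
    simp only [Function.comp, upd]
    split_ifs <;> rfl

end MemFormula

instance : Countable Symbol := by
  have : Finite Keyword := Finite.of_injective (β := Fin 16) (fun k => ⟨k.ctorIdx, by cases k <;> decide⟩)
    fun k l h => by cases k <;> cases l <;> first | rfl | exact absurd (Fin.val_eq_of_eq h) (by decide)
  refine Function.Injective.countable (β := Keyword ⊕ ℕ)
    (f := fun | .kw k => .inl k | .id n => .inr n) ?_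
  rintro (k | m) (l | n) h <;> cases h <;> rfl

open MemFormula in
/-- The downward Löwenheim–Skolem theorem for NBG. -/
theorem NBGModel.exists_countable (N : NBGModel.{u}) [Infinite N.D] (φ : Symbol → N.D) :
    ∃ (N' : NBGModel.{u}) (φ' : Symbol → N'.D), Countable N'.D ∧
      ∀ A, N'.Sat A φ' ↔ N.Sat A φ := by
  let : memLanguage.Structure N.D := memStructure N.mem
  have hmem : relMem N.D = N.mem := rfl
  -- The submodel is made to contain all values of `φ`, of which there are countably many, so that
  -- `φ` is also an assignment into it.
  obtain ⟨S, hS, hcard⟩ := exists_elementarySubstructure_card_eq memLanguage (M := N.D)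
    (Set.range φ) Cardinal.aleph0.{u} le_rfl
    (by simpa only [Cardinal.lift_id, Cardinal.lift_aleph0] using (Set.countable_range φ).le_aleph0)
    (by simpa using card_memLanguage_le)
    (by simp)
  have hNBG : IsNBG (fun x => ∃ y, relMem S x y) (relMem S) := by
    rw [← realize_nbg, S.realize_sentence, realize_nbg, hmem]
    have h := N.isNBG
    rwa [show N.V = fun x => ∃ y, N.mem x y from funext fun x => propext (h.V_iff x)] at h
  let N' : NBGModel.{u} :=
    { D := S
      nonempty := ⟨⟨φ (.id 0), hS ⟨_, rfl⟩⟩⟩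
      V := fun x => ∃ y, relMem S x y
      eq := Eq
      mem := relMem S
      eq_iff := fun _ _ => Iff.rfl
      isNBG := hNBG }
  let : memLanguage.Structure N'.D := inferInstanceAs (memLanguage.Structure S)
  have hcount : Countable S := Cardinal.mk_le_aleph0_iff.1 (by simpa using hcard.le)
  refine ⟨N', fun x => ⟨φ x, hS ⟨x, rfl⟩⟩, hcount, fun A => ?_⟩
  rw [← realize_ofNBGFormula N hmem, ← realize_ofNBGFormula N' rfl]
  -- The inclusion is elementary, hence preserves truth of formulas with parameters.
  exact (S.subtype.map_formula (ofNBGFormula A) fun x => ⟨φ x, hS ⟨x, rfl⟩⟩).symm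

end FirstOrder

-- Structures for `L` over countable models

namespace Prestructure

/-- In a countable model of NBG, countably many symbols and operator names have constructions such
that those of the operator names form a class. -/
theorem exists_constructions (P : Prestructure.{u}) [Countable P.D] (O : Type) [Countable O] :
    ∃ G : Symbol ⊕ O → P.D, Function.Injective G ∧ (∀ a, P.IsSet (G a)) ∧
      (∀ a, P.mem P.empty (G a)) ∧ ∃ c, P.ext c = Set.range fun o => G (.inr o) := by
  obtain ⟨k, T, hk, hT, hdisj, hk', hT'⟩ := P.exists_infinite_class_of_nonpairs
  have := hk.to_subtype
  have := hT.to_subtype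
  obtain ⟨i, hi⟩ := Countable.exists_injective_nat Symbol
  let f : Symbol → T := fun s => Infinite.natEmbedding T (i s)
  have hf : Function.Injective f := (Infinite.natEmbedding T).injective.comp hi
  obtain ⟨g, hg, c, hc⟩ : ∃ g : O → P.ext k, Function.Injective g ∧
      ∃ c, P.ext c = Set.range fun o => (g o : P.D) := by
    cases finite_or_infinite O
    -- Finitely many operator names: any injection into `k` will do, since a finite collection of
    -- sets is a class.
    · obtain ⟨j, hj⟩ := Countable.exists_injective_nat O
      refine ⟨fun o => Infinite.natEmbedding _ (j o),
        (Infinite.natEmbedding _).injective.comp hj, ?_⟩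
      obtain ⟨c, -, hc⟩ := exists_ext_eq_of_finite (P := P)
        (Set.finite_range fun o => ((Infinite.natEmbedding (P.ext k) (j o) : P.ext k) : P.D))
        (by rintro _ ⟨o, rfl⟩; exact ⟨k, (Infinite.natEmbedding (P.ext k) (j o)).2⟩)
      exact ⟨c, hc⟩
    -- Infinitely many operator names: a bijection onto all members of `k` is taken, so that their
    -- codes form the class `k` itself. Countability of the model is used only here.
    · obtain ⟨g⟩ := nonempty_equiv_of_countable (α := O) (β := P.ext k)
      refine ⟨g, g.injective, k, ?_⟩
      exact (Subtype.range_coe (s := P.ext k)).symm.trans (g.surjective.range_comp _).symm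
  refine ⟨Sum.elim (fun s => f s) fun o => g o, ?_, ?_, ?_, c, hc⟩
  · exact (Subtype.val_injective.comp hf).sumElim (Subtype.val_injective.comp hg) fun s o h =>
      Set.disjoint_left.1 hdisj (g o).2 (h ▸ (f s).2)
  · rintro (s | o)
    · exact (hT' _ (f s).2).1
    · exact ⟨k, (g o).2⟩
  · rintro (s | o)
    · exact (hT' _ (f s).2).2
    · exact hk' _ (g o).2

open Classical in
/-- An operation that yields `Y x` where `x ⊆ D_on`. -/
noncomputable def constrOp (P : Prestructure.{u}) (Don : Set P.D) (Y : P.D → Set P.D) :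
    Option P.D → Set P.D
  | none => Set.univ
  -- The value ∅ off the intended domain is one choice that differs from the universal superclass,
  -- the domain being nonempty.
  | some x => if P.ext x ⊆ Don then Y x else ∅

theorem isConstrOp_constrOp (P : Prestructure.{u}) (Don : Set P.D) (Y : P.D → Set P.D) :
    P.IsConstrOp Don Y (P.constrOp Don Y) := by
  have := P.nonempty
  exact ⟨rfl, fun x => ⟨fun h => if_pos h, fun h => by
    simpa only [constrOp, if_neg h] using Set.empty_ne_univ⟩⟩

open Classical in
/-- An operation that yields the constructions of the terms of type `α` at `x ⊆ D_on` and the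
construction of `α`. -/
noncomputable def termTypeOp (P : Prestructure.{u}) (L : Language)
    (G : Symbol ⊕ L.OpName → P.D) : Option P.D → Option P.D → Set P.D
  | some x, some y =>
      if P.ext x ⊆ (Set.range fun o => G (.inr o)) ∧ ∃ α, L.IsType α ∧ P.constr G α = y then
        P.constrSet G {e | ∃ α, P.constr G α = y ∧ L.IsTermOf e α} x
      else ∅
  | _, _ => Set.univ

theorem _root_.Chiron.nonempty_operation (D : Type u) (ss : List SForm) (r : SForm) :
    Nonempty (Operation D ss r) := by
  induction ss with
  | nil => exact ⟨Dom.undef r⟩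
  | cons s ss ih => exact ⟨fun _ => Classical.choice ih⟩

/-- The interpretation of the operator names given by the constructions `G` and by the class `c` of
the constructions of operator names; the operator names that are not built-in have arbitrary
interpretations. -/
noncomputable def interp (P : Prestructure.{u}) (L : Language) (G : Symbol ⊕ L.OpName → P.D)
    (c : P.D) : (o : L.OpName) → Operation P.D (L.θ o).args (L.θ o).res
  | .inl .set => {x | P.IsSet x}
  | .inl .cls => (Set.univ : Set P.D)
  | .inl .opNames => some c
  | .inl .lang => {x | P.ext x ⊆ Set.range fun o => G (.inr o)}
  | .inl .exprSym => Set.range fun s => G (.inl s)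
  | .inl .exprOpName => P.constrOp (Set.range fun o => G (.inr o)) fun x => P.ext x
  | .inl .expr => P.constrOp (Set.range fun o => G (.inr o)) (P.constrSet G Set.univ)
  | .inl .exprOp => P.constrOp (Set.range fun o => G (.inr o)) (P.constrSet G {e | L.IsOp e})
  | .inl .exprType => P.constrOp (Set.range fun o => G (.inr o)) (P.constrSet G {e | L.IsType e})
  | .inl .exprTerm => P.constrOp (Set.range fun o => G (.inr o)) (P.constrSet G {e | L.IsTerm e})
  | .inl .exprTermType => P.termTypeOp L G
  | .inl .exprFormula =>
      P.constrOp (Set.range fun o => G (.inr o)) (P.constrSet G {e | L.IsFormula e})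
  | .inl .mem => fun x y : Option P.D => TV.of (∃ d d', x = some d ∧ y = some d' ∧ P.mem d d')
  | .inl .typeEqual => fun S S' : Set P.D => TV.of (S = S')
  | .inl .termEqual => fun (x y : Option P.D) (S : Set P.D) =>
      TV.of (∃ d ∈ S, x = some d ∧ y = some d)
  | .inl .formulaEqual => fun p q : TV.{u} => TV.of (p = q)
  | .inl .not => fun p : TV.{u} => TV.of (p = .f)
  | .inl .or => fun p q : TV.{u} => TV.of (p = .t ∨ q = .t)
  | .inr _ => Classical.choice (nonempty_operation _ _ _)

/-- Every countable model of NBG is the prestructure of a structure for `L`. -/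
theorem exists_structure (P : Prestructure.{u}) [Countable P.D] (L : Language) :
    ∃ S : Structure.{u} L, S.toPrestructure = P := by
  have := L.countable
  have : Countable BuiltIn := Function.Injective.countable (f := BuiltIn.ctorIdx)
    fun a b h => by cases a <;> cases b <;> first | rfl | exact absurd h (by decide)
  have := P.nonempty
  obtain ⟨G, hG, hset, hemp, c, hc⟩ := P.exists_constructions L.OpName
  have hne : ∀ a, ∃ z, P.mem z (G a) := fun a => ⟨_, hemp a⟩
  have hpair : ∀ a x y, ¬ IsOPair P.mem (G a) x y := fun a => not_isOPair_of_empty_mem (hemp a)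
  classical
  refine ⟨{ P with
    -- The choice function acts on arbitrary superclasses and comes from choice in the metatheory,
    -- not from the axiom of choice in the model.
    ξ := fun S => if h : S.Nonempty then h.some else Classical.choice P.nonempty
    ξ_mem := fun S h => by simpa only [dif_pos h] using h.some_mem
    G := G
    G_injective := hG
    G_isSet := hset
    G_ne_empty := hne
    G_ne_pair := hpair
    I := P.interp L G c
    I_set := rfl
    I_cls := rfl
    I_opNames := ⟨c, rfl, hc⟩
    I_lang := rfl
    I_exprSym := rfl
    I_exprOpName := P.isConstrOp_constrOp _ _
    I_expr := P.isConstrOp_constrOp _ _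
    I_exprOp := P.isConstrOp_constrOp _ _
    I_exprType := P.isConstrOp_constrOp _ _
    I_exprTerm := P.isConstrOp_constrOp _ _
    I_exprTermType := ?_
    I_exprFormula := P.isConstrOp_constrOp _ _
    I_mem := fun _ _ => rfl
    I_typeEqual := fun _ _ => rfl
    I_termEqual := fun _ _ _ => rfl
    I_formulaEqual := fun _ _ => rfl
    I_not := fun _ => rfl
    I_or := fun _ _ => rfl }, rfl⟩
  intro f hf
  obtain rfl : f = P.termTypeOp L G := hf
  refine ⟨?_, fun x α hx hα => ?_, fun x y h => ?_⟩
  · rintro (_ | x) (_ | y) h <;> first | rfl | simp at h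
  · refine (if_pos ⟨hx, α, hα, rfl⟩).trans
      (congrArg (fun E => P.constrSet G E x) (Set.ext fun e => ?_))
    refine ⟨?_, fun h => ⟨α, rfl, h⟩⟩
    rintro ⟨β, hβ, h⟩
    -- `termTypeOp` collects the terms of every type with the given code; by injectivity of the
    -- coding that type is `α`.
    rwa [constr_injective hG hset hne hpair β α hβ] at h
  · rw [show P.termTypeOp L G (some x) (some y) = ∅ from if_neg h]
    exact Set.empty_ne_univ

end Prestructure

-- Faithfulness

/-- The prestructure given by a model of NBG. -/
def NBGModel.toPrestructure (N : NBGModel.{u}) : Prestructure.{u} where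
  D := N.D
  mem := N.mem
  nonempty := N.nonempty
  isNBG := by
    have h := N.isNBG
    rwa [show N.V = fun x => ∃ y, N.mem x y from funext fun x => propext (h.V_iff x)] at h

/-- A model comes with its own predicates for being a set and for equality, which the passage to a
prestructure forgets; the axioms determine them, so truth does not change. -/
theorem NBGModel.sat_toNBGModel (N : NBGModel.{u}) (A : NBGFormula) (φ : Symbol → N.D) :
    N.toPrestructure.toNBGModel.Sat A φ ↔ N.Sat A φ := by
  induction A generalizing φ with
  | isSet x => exact (N.isNBG.V_iff _).symm
  | eq x y => exact (N.eq_iff _ _).symm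
  | mem x y => exact Iff.rfl
  | neg A ih => exact not_congr (ih φ)
  | or A B ihA ihB => exact or_congr (ihA φ) (ihB φ)
  | ex x A ih => exact exists_congr fun d => ih _

theorem NBGModel.infinite (N : NBGModel.{u}) : Infinite N.D :=
  Set.infinite_univ_iff.1 (N.toPrestructure.infinite_isSet.mono (Set.subset_univ _))

theorem Language.valid_Φ_of_nbgValid (L : Language) {A : NBGFormula} (h : NBGValid.{u} A) :
    Valid.{u} L (L.Φ A) :=
  fun S φ => (S.val_Φ_eq_true_iff A φ).2 (h S.toNBGModel φ)

theorem Language.nbgValid_of_valid_Φ (L : Language) {A : NBGFormula}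
    (h : Valid.{u} L (L.Φ A)) : NBGValid.{u} A := by
  intro N φ
  have := N.infinite
  obtain ⟨N', φ', hcount, hsat⟩ := N.exists_countable φ
  rw [← hsat, ← N'.sat_toNBGModel]
  have : Countable N'.toPrestructure.D := hcount
  -- Stated for a variable `P`, so that `P` can be replaced by the prestructure of the structure
  -- constructed on it.
  have key : ∀ (P : Prestructure.{u}) [Countable P.D] (ψ : Symbol → P.D),
      P.toNBGModel.Sat A ψ := by
    intro P _ ψ
    obtain ⟨S, rfl⟩ := P.exists_structure L
    exact (S.val_Φ_eq_true_iff A ψ).1 (h S ψ)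
  exact key N'.toPrestructure φ'

end Chiron

theorem mainTheorem4 (L : Chiron.Language) :
    (∀ A : Chiron.NBGFormula,
      Chiron.NBGValid.{u} A ↔ Chiron.Language.Valid.{u} L (L.Φ A)) ∧
    Chiron.Language.IsFaithfulInterpretation.{u} L L.Φvar L.Φ :=
  ⟨fun _ => ⟨L.valid_Φ_of_nbgValid, L.nbgValid_of_valid_Φ⟩,
    ⟨L.isTranslation_Φ, fun _ => L.valid_Φ_of_nbgValid⟩, fun _ => L.nbgValid_of_valid_Φ⟩
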